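/- **Setting.** A *centrally symmetric convex domain* is a compact convex set $K\subset\mathbb{R}^2$ with nonempty interior that has a center of symmetry $c$ (that is, $2c-x\in K$ for all $x\in K$). For such $K$ let $\delta_{\mathrm{lat}}(K)$ be the maximum of $\operatorname{area}(K)/\operatorname{covol}(\Lambda)$ over all lattices $\Lambda\subset\mathbb{R}^2$ of full rank for which the translates $\lambda+K$, $\lambda\in\Lambda$, have pairwise disjoint interiors. Let $\delta_{\min}$ be the infimum of $\delta_{\mathrm{lat}}(K)$ over all centrally symmetric convex domains $K$. A *miserly domain* is a centrally symmetric convex domain $K$ with $\delta_{\mathrm{lat}}(K)=\delta_{\min}$. Write $u\wedge v$ for the determinant of the $2\times2$ matrix with columns $u,v\in\mathbb{R}^2$. A *multi-curve* on an interval $[t_0,t_1]$, $t_0<t_1$, is a family of $C^1$ curves $\sigma_j:[t_0,t_1]\to\mathbb{R}^2$, $j\in\mathbb{Z}/6\mathbb{Z}$, such that for all $j$ and $t$ $$\sigma_j(t)+\sigma_{j+2}(t)+\sigma_{j+4}(t)=0,\qquad \sigma_{j+3}(t)=-\sigma_j(t),\qquad \sigma_j(t)\wedge\sigma_{j+2}(t)=\tfrac{\sqrt3}{2}.$$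 It has *well-defined rank* if all $\sigma_j$ are $C^2$ on $[t_0,t_1]$ and each $\sigma_j$ either is a line segment or has nonzero curvature at every point of the open interval $(t_0,t_1)$. Its *rank* is then the number of indices $j\in\{0,2,4\}\subset\mathbb{Z}/6\mathbb{Z}$ for which $\sigma_j$ is not a line segment. A multi-curve $\sigma$ *parametrizes a segment of the boundary* of $K$ if, for the center of symmetry $c$ of $K$ and some scale $r>0$, the points $c+r\,\sigma_j(t)$ lie on $\partial K$ for all $j\in\mathbb{Z}/6\mathbb{Z}$ and all $t\in[t_0,t_1]$. **Theorem.** Let $K$ be a miserly domain. Then there is no segment of the boundary of $K$ that is parametrized by a multi-curve of well-defined rank three. -/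

import Mathlib

open Set MeasureTheory
open scoped Pointwise

noncomputable section

namespace Reinhardt

/-- The Euclidean plane. -/
abbrev Plane : Type := EuclideanSpace ℝ (Fin 2)

/-- The determinant `u ∧ v` of the `2 × 2` matrix with columns `u` and `v`. -/
def wedge (u v : Plane) : ℝ := u 0 * v 1 - u 1 * v 0

/-! ### Centrally symmetric convex domains and their lattice packings -/

/-- `c` is a center of symmetry of `K`. -/
def IsCenter (K : Set Plane) (c : Plane) : Prop :=
  ∀ x ∈ K, (2 : ℝ) • c - x ∈ K

/-- A centrally symmetric convex domain: a compact convex set with nonempty interior that has a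
center of symmetry (not necessarily the origin). -/
structure IsCentrallySymmetricConvexDomain (K : Set Plane) : Prop where
  convex : Convex ℝ K
  isCompact : IsCompact K
  nonempty_interior : (interior K).Nonempty
  exists_center : ∃ c, IsCenter K c

/-- The translates of `K` by the vectors of `L` have disjoint interiors. -/
def IsPacking (L : Submodule ℤ Plane) (K : Set Plane) : Prop :=
  (L : Set Plane).PairwiseDisjoint fun v => interior (v +ᵥ K)

/-- The densities `area K / covolume L` of the packings of `K` by full-rank lattices `L`. -/
def latticeDensities (K : Set Plane) : Set ℝ :=
  {d | ∃ (L : Submodule ℤ Plane) (_ : DiscreteTopology L) (_ : IsZLattice ℝ L),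
    IsPacking L K ∧ d = volume.real K / ZLattice.covolume L}

/-- The greatest density of a lattice packing of `K`. -/
def deltaLat (K : Set Plane) : ℝ := sSup (latticeDensities K)

/-- The infimum of `deltaLat K` over all centrally symmetric convex domains `K`. -/
def deltaMin : ℝ := sInf (deltaLat '' {K | IsCentrallySymmetricConvexDomain K})

/-- A miserly domain: a centrally symmetric convex domain that realizes `deltaMin`. -/
structure IsMiserly (K : Set Plane) : Prop where
  domain : IsCentrallySymmetricConvexDomain K
  minimal : deltaLat K = deltaMin

/-! ### Multi-curves and their rank -/

/-- A multi-point: six points `u j` of the plane, indexed by `ℤ/6ℤ`. -/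
structure IsMultiPoint (u : ZMod 6 → Plane) : Prop where
  sum_eq_zero : ∀ j, u j + u (j + 2) + u (j + 4) = 0
  neg : ∀ j, u (j + 3) = -u j
  wedge_eq : ∀ j, wedge (u j) (u (j + 2)) = √3 / 2

/-- A multi-curve on the (nondegenerate) interval `[t₀, t₁]`: six `C¹` curves that form a
multi-point at each time. -/
structure IsMultiCurve (σ : ZMod 6 → ℝ → Plane) (t₀ t₁ : ℝ) : Prop where
  lt : t₀ < t₁
  contDiffOn : ∀ j, ContDiffOn ℝ 1 (σ j) (Icc t₀ t₁)
  isMultiPoint : ∀ t ∈ Icc t₀ t₁, IsMultiPoint fun j => σ j t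

/-- The signed curvature of the parametrized plane curve `γ` at time `t`. It is used only at
interior times of curves of class `C²`. Where `γ' = 0` the value is `0`, so that a curve with
nonzero curvature at `t` is regular at `t`. -/
def curvature (γ : ℝ → Plane) (t : ℝ) : ℝ :=
  wedge (deriv γ t) (deriv (deriv γ) t) / ‖deriv γ t‖ ^ 3

/-- The curve `γ` on `[t₀, t₁]` is a (nondegenerate) line segment. -/
def IsLineSegment (γ : ℝ → Plane) (t₀ t₁ : ℝ) : Prop :=
  ∃ p q : Plane, p ≠ q ∧ γ '' Icc t₀ t₁ = segment ℝ p q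

/-- The multi-curve `σ` on `[t₀, t₁]` has a well-defined rank: it is of class `C²`, and each of
its curves is a line segment or has nonzero curvature on the open interval `(t₀, t₁)`. -/
structure HasWellDefinedRank (σ : ZMod 6 → ℝ → Plane) (t₀ t₁ : ℝ) : Prop where
  contDiffOn : ∀ j, ContDiffOn ℝ 2 (σ j) (Icc t₀ t₁)
  segment_or_curved : ∀ j,
    IsLineSegment (σ j) t₀ t₁ ∨ ∀ t ∈ Ioo t₀ t₁, curvature (σ j) t ≠ 0

/-- The number of even indices `j` in `ℤ/6ℤ` for which `σ j` is not a line segment. -/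
def rank (σ : ZMod 6 → ℝ → Plane) (t₀ t₁ : ℝ) : ℕ :=
  Set.ncard {j : ZMod 6 | Even j ∧ ¬ IsLineSegment (σ j) t₀ t₁}

/-- The multi-curve `σ` on `[t₀, t₁]` parametrizes a segment of the boundary of the centrally
symmetric domain `K`, after `K` is recentered at the origin and rescaled. The translation is by
the center `c` of `K`. The scale `r` is any positive number, so that no normalization of `K` is
presupposed. -/
def ParametrizesBoundary (σ : ZMod 6 → ℝ → Plane) (t₀ t₁ : ℝ) (K : Set Plane) : Prop :=
  ∃ (c : Plane) (r : ℝ), IsCenter K c ∧ 0 < r ∧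
    ∀ j, ∀ t ∈ Icc t₀ t₁, c + r • σ j t ∈ frontier K

end Reinhardt

end

/-! Move the center to the origin. Doubling the lattice spanned by two adjacent vertices of an
inscribed affine-regular hexagon gives a packing (`IsInscribed.exists_isPacking`), and no packing
lattice has smaller covolume than all lattices of this kind (`exists_isInscribed_le_covolume`). The
lattice density is thus governed by the area of `K` relative to its small inscribed hexagons. To
lower it, it suffices to lower the area without creating smaller hexagons (`deltaLat_lt`).

A rank-three multi-curve is a moving inscribed hexagon of constant area, all of whose vertices trace
strictly curved boundary arcs. On a short interval, deform the hexagon at time `t`, in the frame in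
which it is regular, by the matrix `exp (ε b(t) R(ωt))`. Here `R(θ)` is the symmetric reflection
matrix with rows `(cos θ, sin θ)` and `(sin θ, -cos θ)`, and `b` vanishes with its derivative at the
ends. The determinant is one, so the areas of the hexagons are kept. End points and end tangents are
kept as well, and for small `ε` the arcs stay strictly convex, so that they can replace the old ones
in the boundary (`exists_replace_arcs`). All hexagons inscribed at a given vertex have the same area
(`IsInscribed.wedge_eq`). Hence a hexagon inscribed in the new body either has a vertex on a new arc
and the old constant area, or is inscribed in `K`.

It remains to lose area. Adding the areas for `ε` and `-ε` cancels the first-order terms. What is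
left is the integral of a positive multiple of `sinh² (ε b)` times `E + 6 ω w / √3`, where `E` is
the area form of the original arcs and `w` the wedge product of adjacent vertices. A fast
oscillation with `ω` very negative makes this negative, so one of the two signs yields a smaller
area (`IsHexCurve.exists_deformation`). The new body then has density below `deltaMin`. -/

namespace Reinhardt

/-! ### The wedge product -/

theorem wedge_add_left (u v w : Plane) : wedge (u + v) w = wedge u w + wedge v w := by
  simp [wedge]; ring

theorem wedge_add_right (u v w : Plane) : wedge u (v + w) = wedge u v + wedge u w := by
  simp [wedge]; ring

theorem wedge_smul_left (a : ℝ) (u v : Plane) : wedge (a • u) v = a * wedge u v := by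
  simp [wedge]; ring

theorem wedge_smul_right (a : ℝ) (u v : Plane) : wedge u (a • v) = a * wedge u v := by
  simp [wedge]; ring

theorem wedge_neg_left (u v : Plane) : wedge (-u) v = -wedge u v := by
  simp [wedge]; ring

theorem wedge_neg_right (u v : Plane) : wedge u (-v) = -wedge u v := by
  simp [wedge]; ring

theorem wedge_sub_right (u v w : Plane) : wedge u (v - w) = wedge u v - wedge u w := by
  simp [wedge]; ring

@[simp] theorem wedge_self (u : Plane) : wedge u u = 0 := by
  simp [wedge]; ring

@[simp] theorem wedge_zero_left (u : Plane) : wedge 0 u = 0 := by simp [wedge]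

@[simp] theorem wedge_zero_right (u : Plane) : wedge u 0 = 0 := by simp [wedge]

theorem wedge_swap (u v : Plane) : wedge u v = -wedge v u := by
  simp [wedge]; ring

theorem plane_ext {x y : Plane} (h₀ : x 0 = y 0) (h₁ : x 1 = y 1) : x = y := by
  ext i; fin_cases i
  · exact h₀
  · exact h₁

/-- Cramer's rule. -/
theorem wedge_smul_eq (u v x : Plane) :
    wedge u v • x = wedge x v • u + wedge u x • v := by
  apply plane_ext <;> simp [wedge] <;> ring

theorem eq_of_wedge_ne_zero {u v : Plane} (h : wedge u v ≠ 0) (x : Plane) :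
    x = (wedge x v / wedge u v) • u + (wedge u x / wedge u v) • v := by
  have := wedge_smul_eq u v x
  rw [div_eq_inv_mul, div_eq_inv_mul, mul_smul, mul_smul, ← smul_add, ← this, smul_smul,
    inv_mul_cancel₀ h, one_smul]

theorem ne_zero_of_wedge_left {u v : Plane} (h : wedge u v ≠ 0) : u ≠ 0 := by
  rintro rfl; simp at h

theorem ne_zero_of_wedge_right {u v : Plane} (h : wedge u v ≠ 0) : v ≠ 0 := by
  rintro rfl; simp at h

theorem exists_smul_eq_of_wedge_eq_zero {u x : Plane} (hu : u ≠ 0) (h : wedge u x = 0) :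
    ∃ a : ℝ, x = a • u := by
  have h' : u 0 * x 1 = u 1 * x 0 := by simpa [wedge, sub_eq_zero] using h
  by_cases h0 : u 0 = 0
  · have h1 : u 1 ≠ 0 := fun h1 => hu (plane_ext (by simpa using h0) (by simpa using h1))
    refine ⟨x 1 / u 1, plane_ext ?_ ?_⟩
    · have : x 0 = 0 := by
        rw [h0, zero_mul] at h'
        rcases mul_eq_zero.1 h'.symm with h | h
        · exact absurd h h1
        · exact h
      simp [h0, this]
    · simp [h1]
  · refine ⟨x 0 / u 0, plane_ext ?_ ?_⟩
    · simp [h0]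
    · simp only [PiLp.smul_apply, smul_eq_mul]
      field_simp
      linarith

/-- The coordinate functional. -/
theorem continuous_coord (i : Fin 2) : Continuous fun x : Plane => x i :=
  (EuclideanSpace.proj (𝕜 := ℝ) i).continuous

theorem _root_.ContinuousOn.wedge {X : Type*} [TopologicalSpace X] {f g : X → Plane} {s : Set X}
    (hf : ContinuousOn f s) (hg : ContinuousOn g s) :
    ContinuousOn (fun x => Reinhardt.wedge (f x) (g x)) s := by
  have h (i : Fin 2) {f : X → Plane} (hf : ContinuousOn f s) : ContinuousOn (fun x => f x i) s :=
    (continuous_coord i).comp_continuousOn hf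
  exact ((h 0 hf).mul (h 1 hg)).sub ((h 1 hf).mul (h 0 hg))

theorem _root_.ContinuousAt.wedge {X : Type*} [TopologicalSpace X] {f g : X → Plane} {x : X}
    (hf : ContinuousAt f x) (hg : ContinuousAt g x) :
    ContinuousAt (fun x => Reinhardt.wedge (f x) (g x)) x := by
  have h (i : Fin 2) {f : X → Plane} (hf : ContinuousAt f x) : ContinuousAt (fun x => f x i) x :=
    (continuous_coord i).continuousAt.comp hf
  exact ((h 0 hf).mul (h 1 hg)).sub ((h 1 hf).mul (h 0 hg))

theorem _root_.Continuous.wedge {X : Type*} [TopologicalSpace X] {f g : X → Plane}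
    (hf : Continuous f) (hg : Continuous g) :
    Continuous (fun x => Reinhardt.wedge (f x) (g x)) :=
  continuous_iff_continuousAt.2 fun _ => hf.continuousAt.wedge hg.continuousAt

theorem _root_.HasDerivAt.coord {γ : ℝ → Plane} {d : Plane} {t : ℝ} (h : HasDerivAt γ d t)
    (i : Fin 2) : HasDerivAt (fun s => γ s i) (d i) t :=
  (EuclideanSpace.proj (𝕜 := ℝ) i).hasFDerivAt.comp_hasDerivAt t h

theorem _root_.HasDerivAt.const_wedge {γ : ℝ → Plane} {d : Plane} {t : ℝ} (h : HasDerivAt γ d t)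
    (w : Plane) : HasDerivAt (fun s => wedge w (γ s)) (wedge w d) t :=
  ((h.coord 1).const_mul (w 0)).sub ((h.coord 0).const_mul (w 1))

/-! ### Convex bodies around the origin and their gauge -/

/-- A compact convex set with the origin in its interior. -/
structure IsBody (K : Set Plane) : Prop where
  convex : Convex ℝ K
  isCompact : IsCompact K
  zero_mem : (0 : Plane) ∈ interior K

namespace IsBody

variable {K : Set Plane} (hK : IsBody K)
include hK

theorem mem_nhds : K ∈ nhds (0 : Plane) := mem_interior_iff_mem_nhds.1 hK.zero_mem

theorem absorbent : Absorbent ℝ K := absorbent_nhds_zero hK.mem_nhds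

theorem isClosed : IsClosed K := hK.isCompact.isClosed

theorem gauge_pos {x : Plane} (hx : x ≠ 0) : 0 < gauge K x :=
  (_root_.gauge_pos hK.absorbent
    (NormedSpace.isVonNBounded_of_isBounded ℝ hK.isCompact.isBounded)).2 hx

theorem gauge_lt_one {x : Plane} : gauge K x < 1 ↔ x ∈ interior K :=
  gauge_lt_one_iff_mem_interior hK.convex hK.mem_nhds

theorem gauge_eq_one {x : Plane} : gauge K x = 1 ↔ x ∈ frontier K :=
  gauge_eq_one_iff_mem_frontier hK.convex hK.mem_nhds

theorem gauge_le_one {x : Plane} : gauge K x ≤ 1 ↔ x ∈ K := by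
  rw [gauge_le_one_iff_mem_closure hK.convex hK.mem_nhds, hK.isClosed.closure_eq]

theorem continuous_gauge : Continuous (gauge K) := _root_.continuous_gauge hK.convex hK.mem_nhds

theorem gauge_add (x y : Plane) : gauge K (x + y) ≤ gauge K x + gauge K y :=
  gauge_add_le hK.convex hK.absorbent x y

omit hK in
theorem gauge_smul {a : ℝ} (ha : 0 ≤ a) (x : Plane) : gauge K (a • x) = a * gauge K x := by
  rw [gauge_smul_of_nonneg ha, smul_eq_mul]

theorem gauge_combo {a b : ℝ} (ha : 0 ≤ a) (hb : 0 ≤ b) (x y : Plane) :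
    gauge K (a • x + b • y) ≤ a * gauge K x + b * gauge K y := by
  have := hK.gauge_add (a • x) (b • y)
  rwa [gauge_smul ha, gauge_smul hb] at this

theorem frontier_subset : frontier K ⊆ K := hK.isClosed.frontier_subset

theorem ne_zero_of_mem_frontier {x : Plane} (hx : x ∈ frontier K) : x ≠ 0 := by
  rintro rfl
  exact hx.2 hK.zero_mem

theorem exists_mem_frontier {x : Plane} (hx : x ∉ K) :
    ∃ y ∈ frontier K, ∃ μ : ℝ, 1 < μ ∧ x = μ • y := by
  have h1 : 1 < gauge K x := by
    by_contra h
    exact hx (hK.gauge_le_one.1 (not_lt.1 h))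
  have h0 : 0 < gauge K x := by linarith
  refine ⟨(gauge K x)⁻¹ • x, ?_, gauge K x, h1, ?_⟩
  · rw [← hK.gauge_eq_one, gauge_smul (inv_nonneg.2 h0.le), inv_mul_cancel₀ h0.ne']
  · rw [smul_smul, mul_inv_cancel₀ h0.ne', one_smul]

theorem smul_mem_iff {x : Plane} (hx : x ∈ frontier K) {a : ℝ} (ha : 0 ≤ a) :
    a • x ∈ K ↔ a ≤ 1 := by
  rw [← hK.gauge_le_one, gauge_smul ha, hK.gauge_eq_one.2 hx, mul_one]

theorem smul_mem_interior_iff {x : Plane} (hx : x ∈ frontier K) {a : ℝ} (ha : 0 ≤ a) :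
    a • x ∈ interior K ↔ a < 1 := by
  rw [← hK.gauge_lt_one, gauge_smul ha, hK.gauge_eq_one.2 hx, mul_one]

end IsBody

/-! ### Inscribed hexagons -/

/-- The vectors `u`, `v`, `v - u` and their negatives are the vertices, in counterclockwise order,
of an affine-regular hexagon inscribed in `K`. -/
structure IsInscribed (K : Set Plane) (u v : Plane) : Prop where
  left : u ∈ frontier K
  right : v ∈ frontier K
  sub : v - u ∈ frontier K
  pos : 0 < wedge u v

theorem neg_mem_frontier {K : Set Plane} (hs : ∀ x ∈ K, -x ∈ K) {x : Plane}
    (hx : x ∈ frontier K) : -x ∈ frontier K := by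
  have h : -K = K := by
    ext y
    exact ⟨fun h => by simpa using hs _ h, fun h => hs _ h⟩
  have h2 : frontier ((Homeomorph.neg Plane) ⁻¹' K) = (Homeomorph.neg Plane) ⁻¹' frontier K :=
    ((Homeomorph.neg Plane).preimage_frontier K).symm
  have h3 : (Homeomorph.neg Plane) ⁻¹' K = K := h
  rw [h3] at h2
  rw [h2] at hx
  exact hx

section Hexagon

variable {K : Set Plane} (hK : IsBody K) (hs : ∀ x ∈ K, -x ∈ K)
include hs

/-- This lets any vertex of the hexagon, up to sign, take the place of the distinguished vertex `u`.
-/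
theorem IsInscribed.rotate {u v : Plane} (h : IsInscribed K u v) : IsInscribed K v (v - u) := by
  refine ⟨h.right, h.sub, ?_, ?_⟩
  · rw [show v - u - v = -u by abel]
    exact neg_mem_frontier hs h.left
  · rw [wedge_sub_right, wedge_self, wedge_swap]
    linarith [h.pos]

include hK

/-- In the coordinates `x`, `y`, the row of the hexagon at height `y` is `-1 ≤ x ≤ 1 - y`. The three
cases are the triangles into which the upper half of the hexagon is cut from the origin. -/
theorem IsInscribed.gauge_lt {u v : Plane} (h : IsInscribed K u v) {x y : ℝ} (hx : -1 < x)
    (hy : 0 ≤ y) (hxy : x < 1 - y) (hy1 : y < 1) : gauge K (x • u + y • v) < 1 := by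
  have gu := hK.gauge_eq_one.2 h.left
  have gv := hK.gauge_eq_one.2 h.right
  have gs := hK.gauge_eq_one.2 h.sub
  have gn : gauge K (-u) = 1 := by rw [gauge_neg hs, gu]
  rcases le_or_gt 0 x with h0 | h0
  · have := hK.gauge_combo h0 hy u v
    rw [gu, gv] at this
    linarith
  rcases le_or_gt (-x) y with h1 | h1
  · have := hK.gauge_combo (a := -x) (b := y + x) (by linarith) (by linarith) (v - u) v
    rw [gs, gv, show (-x) • (v - u) + (y + x) • v = x • u + y • v by module] at this
    linarith
  · have := hK.gauge_combo (a := y) (b := -x - y) hy (by linarith) (v - u) (-u)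
    rw [gs, gn, show y • (v - u) + (-x - y) • (-u) = x • u + y • v by module] at this
    linarith

theorem IsInscribed.wedge_le {u v w : Plane} (hv : IsInscribed K u v) (hw : IsInscribed K u w) :
    wedge u v ≤ wedge u w := by
  by_contra! hlt
  have hne := hv.pos.ne'
  set x := wedge w v / wedge u v with hx
  set y := wedge u w / wedge u v with hy
  have hwe : w = x • u + y • v := eq_of_wedge_ne_zero hne w
  have hy0 : 0 < y := div_pos hw.pos hv.pos
  have hy1 : y < 1 := (div_lt_one hv.pos).2 hlt
  have g1 : gauge K w = 1 := hK.gauge_eq_one.2 hw.right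
  have g2 : gauge K (w - u) = 1 := hK.gauge_eq_one.2 hw.sub
  have gv : gauge K v = 1 := hK.gauge_eq_one.2 hv.right
  have e2 : w - u = (x - 1) • u + y • v := by rw [hwe]; module
  -- The points `w` and `w - u` lie in the same row, at distance one in the coordinate `x`, and
  -- neither is interior. The row has length `2 - y > 1`, so both lie beyond the same end of it.
  have c1 : x ≤ -1 ∨ 1 - y ≤ x := by
    by_contra! hc
    have := hv.gauge_lt hK hs hc.1 hy0.le hc.2 hy1
    rw [← hwe, g1] at this
    exact lt_irrefl _ this
  have c2 : x - 1 ≤ -1 ∨ 1 - y ≤ x - 1 := by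
    by_contra! hc
    have := hv.gauge_lt hK hs hc.1 hy0.le hc.2 hy1
    rw [← e2, g2] at this
    exact lt_irrefl _ this
  -- Beyond the left end, `w` is a nonnegative combination of `w - u` and `v` with coefficients of
  -- sum less than one, so its gauge is less than one. Beyond the right end, the same holds for `w -
  -- u` in terms of `w` and `v`.
  rcases c1 with c1 | c1
  · have hd : 0 < 1 - x := by linarith
    have hq : 0 ≤ -x / (1 - x) := div_nonneg (by linarith) hd.le
    have := hK.gauge_combo (a := -x / (1 - x)) (b := y / (1 - x)) hq (by positivity) (w - u) v
    rw [e2, show (-x / (1 - x)) • ((x - 1) • u + y • v) + (y / (1 - x)) • v = x • u + y • v by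
      (match_scalars <;> field_simp) <;> ring, ← hwe, ← e2, g1, g2, gv] at this
    have h3 : -x / (1 - x) * 1 + y / (1 - x) * 1 = (-x + y) / (1 - x) := by ring
    rw [h3, le_div_iff₀ hd] at this
    linarith
  rcases c2 with c2 | c2
  · linarith
  · have hd : 0 < x := by linarith
    have := hK.gauge_combo (a := (x - 1) / x) (b := y / x) (div_nonneg (by linarith) hd.le)
      (by positivity) w v
    rw [hwe, show ((x - 1) / x) • (x • u + y • v) + (y / x) • v = (x - 1) • u + y • v by
      (match_scalars <;> field_simp); ring, ← hwe, ← e2, g1, g2, gv] at this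
    have h3 : (x - 1) / x * 1 + y / x * 1 = (x - 1 + y) / x := by ring
    rw [h3, le_div_iff₀ hd] at this
    linarith

/-- All inscribed affine-regular hexagons with a given vertex have the same area. -/
theorem IsInscribed.wedge_eq {u v w : Plane} (hv : IsInscribed K u v) (hw : IsInscribed K u w) :
    wedge u v = wedge u w :=
  le_antisymm (hv.wedge_le hK hs hw) (hw.wedge_le hK hs hv)

/-- Each boundary point is a vertex of an inscribed affine-regular hexagon. -/
theorem exists_isInscribed {u : Plane} (hu : u ∈ frontier K) : ∃ v, IsInscribed K u v := by
  have hu0 := hK.ne_zero_of_mem_frontier hu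
  obtain ⟨w, hw⟩ : ∃ w : Plane, 0 < wedge u w := by
    refine ⟨!₂[-u 1, u 0], ?_⟩
    have : wedge u !₂[-u 1, u 0] = u 0 ^ 2 + u 1 ^ 2 := by simp [wedge]; ring
    rw [this]
    by_contra! h
    have h0 : u 0 = 0 := by nlinarith [sq_nonneg (u 0), sq_nonneg (u 1)]
    have h1 : u 1 = 0 := by nlinarith [sq_nonneg (u 0), sq_nonneg (u 1)]
    exact hu0 (plane_ext (by simpa using h0) (by simpa using h1))
  have gu := hK.gauge_eq_one.2 hu
  let γ : ℝ → Plane := fun θ => Real.cos θ • u + Real.sin θ • w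
  have hγw (θ : ℝ) : wedge u (γ θ) = Real.sin θ * wedge u w := by
    simp [γ, wedge_add_right, wedge_smul_right]
  have hγ0 (θ : ℝ) : γ θ ≠ 0 := by
    intro h
    have h1 := hγw θ
    rw [h, wedge_zero_right] at h1
    have hsin : Real.sin θ = 0 := by
      rcases mul_eq_zero.1 h1.symm with h | h
      · exact h
      · exact absurd h hw.ne'
    have h2 : Real.cos θ • u = 0 := by simpa [γ, hsin] using h
    have hcos : Real.cos θ = 0 := by
      rcases smul_eq_zero.1 h2 with h | h
      · exact h
      · exact absurd h hu0
    have := Real.sin_sq_add_cos_sq θ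
    rw [hsin, hcos] at this
    norm_num at this
  have hγc : Continuous γ := by fun_prop
  let f : ℝ → Plane := fun θ => (gauge K (γ θ))⁻¹ • γ θ
  have hfc : Continuous f :=
    ((hK.continuous_gauge.comp hγc).inv₀ fun θ => (hK.gauge_pos (hγ0 θ)).ne').smul hγc
  have hff (θ : ℝ) : f θ ∈ frontier K := by
    have h0 := hK.gauge_pos (hγ0 θ)
    rw [← hK.gauge_eq_one, IsBody.gauge_smul (inv_nonneg.2 h0.le), inv_mul_cancel₀ h0.ne']
  have hf0 : f 0 = u := by simp [f, γ, gu]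
  have hfπ : f Real.pi = -u := by simp [f, γ, gauge_neg hs, gu]
  have hg : ContinuousOn (fun θ => gauge K (f θ - u)) (Icc 0 Real.pi) :=
    (hK.continuous_gauge.comp (hfc.sub continuous_const)).continuousOn
  have := intermediate_value_Icc Real.pi_pos.le hg
  -- As the boundary point runs over the upper arc from `u` to `-u`, its gauge distance from `u`
  -- grows from `0` to `2`, so it takes the value `1`.
  have h1 : (1 : ℝ) ∈ Icc (gauge K (f 0 - u)) (gauge K (f Real.pi - u)) := by
    rw [hf0, hfπ, sub_self, gauge_zero, show -u - u = (2 : ℝ) • (-u) by module,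
      IsBody.gauge_smul (by norm_num), gauge_neg hs, gu]
    norm_num
  obtain ⟨θ, hθ, hθ1⟩ := this h1
  refine ⟨f θ, hu, hff θ, hK.gauge_eq_one.1 hθ1, ?_⟩
  have hsin : 0 < Real.sin θ := by
    apply Real.sin_pos_of_pos_of_lt_pi
    · rcases hθ.1.eq_or_lt with h | h
      · simp only [← h] at hθ1
        rw [hf0, sub_self, gauge_zero] at hθ1
        norm_num at hθ1
      · exact h
    · rcases hθ.2.eq_or_lt with h | h
      · simp only [h] at hθ1
        rw [hfπ, show -u - u = (2 : ℝ) • (-u) by module, IsBody.gauge_smul (by norm_num),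
          gauge_neg hs, gu] at hθ1
        norm_num at hθ1
      · exact h
  rw [wedge_smul_right, hγw]
  have := hK.gauge_pos (hγ0 θ)
  positivity

/-! ### Packings -/

theorem isPacking_iff {L : Submodule ℤ Plane} :
    IsPacking L K ↔ ∀ v ∈ L, v ≠ 0 → 2 ≤ gauge K v := by
  constructor
  · intro h v hv hv0
    by_contra! hlt
    have hg : gauge K ((2 : ℝ)⁻¹ • v) < 1 := by
      rw [IsBody.gauge_smul (by norm_num)]
      linarith
    have h1 : (2 : ℝ)⁻¹ • v ∈ interior K := hK.gauge_lt_one.1 hg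
    have h2 : -((2 : ℝ)⁻¹ • v) ∈ interior K := by
      rw [← hK.gauge_lt_one, gauge_neg hs]
      exact hg
    have hd := h (zero_mem L : (0 : Plane) ∈ (L : Set Plane)) hv hv0.symm
    refine Set.disjoint_left.1 hd (?_ : (2 : ℝ)⁻¹ • v ∈ _) ?_
    · change _ ∈ interior ((0 : Plane) +ᵥ K)
      rwa [zero_vadd]
    · change _ ∈ interior (v +ᵥ K)
      rw [interior_vadd, Set.mem_vadd_set]
      exact ⟨_, h2, by rw [vadd_eq_add]; module⟩
  · intro h v hv v' hv' hne
    refine Set.disjoint_left.2 fun x hx hx' => ?_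
    change x ∈ interior (v +ᵥ K) at hx
    change x ∈ interior (v' +ᵥ K) at hx'
    rw [interior_vadd, Set.mem_vadd_set] at hx hx'
    obtain ⟨y, hy, rfl⟩ := hx
    obtain ⟨y', hy', he⟩ := hx'
    simp only [vadd_eq_add] at he
    have h1 := h (v - v') (sub_mem hv hv') (sub_ne_zero.2 hne)
    have h2 := hK.gauge_add y' (-y)
    rw [gauge_neg hs, show y' + -y = v - v' by
      rw [eq_sub_iff_add_eq, show y' + -y + v' = v' + y' - y by abel, he]; abel] at h2
    have := hK.gauge_lt_one.2 hy
    have := hK.gauge_lt_one.2 hy'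
    linarith

end Hexagon

/-! ### Lattices spanned by inscribed hexagons -/

theorem linearIndependent_of_wedge_ne_zero {u v : Plane} (h : wedge u v ≠ 0) :
    LinearIndependent ℝ ![u, v] := by
  rw [LinearIndependent.pair_iff]
  intro a b hab
  have h1 : wedge (a • u + b • v) v = 0 := by rw [hab, wedge_zero_left]
  have h2 : wedge u (a • u + b • v) = 0 := by rw [hab, wedge_zero_right]
  simp only [wedge_add_left, wedge_add_right, wedge_smul_left, wedge_smul_right, wedge_self,
    mul_zero, add_zero, zero_add, mul_eq_zero, h, or_false] at h1 h2
  exact ⟨h1, h2⟩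

/-- The basis formed by two vectors of nonzero wedge product. -/
noncomputable def wedgeBasis (u v : Plane) (h : wedge u v ≠ 0) : Module.Basis (Fin 2) ℝ Plane :=
  basisOfLinearIndependentOfCardEqFinrank (linearIndependent_of_wedge_ne_zero h) (by simp)

theorem coe_wedgeBasis (u v : Plane) (h : wedge u v ≠ 0) : ⇑(wedgeBasis u v h) = ![u, v] :=
  coe_basisOfLinearIndependentOfCardEqFinrank _ _

/-- The area of the unit square. -/
noncomputable def unitArea : ℝ :=
  volume.real (ZSpan.fundamentalDomain (EuclideanSpace.basisFun (Fin 2) ℝ).toBasis)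

theorem volume_fundamentalDomain_ne_top (b : Module.Basis (Fin 2) ℝ Plane) :
    volume (ZSpan.fundamentalDomain b) ≠ ⊤ :=
  (ZSpan.fundamentalDomain_isBounded b).measure_lt_top.ne

theorem unitArea_pos : 0 < unitArea :=
  ENNReal.toReal_pos (ZSpan.measure_fundamentalDomain_ne_zero _)
    (volume_fundamentalDomain_ne_top _)

/-- The factor `unitArea` stays symbolic: only its positivity is needed to compare covolumes. -/
theorem volume_real_fundamentalDomain_wedgeBasis (u v : Plane) (h : wedge u v ≠ 0) :
    volume.real (ZSpan.fundamentalDomain (wedgeBasis u v h)) = |wedge u v| * unitArea := by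
  rw [measureReal_def, ZSpan.measure_fundamentalDomain _ _
    (EuclideanSpace.basisFun (Fin 2) ℝ).toBasis, ENNReal.toReal_mul,
    ENNReal.toReal_ofReal (abs_nonneg _), unitArea, measureReal_def, coe_wedgeBasis]
  congr 2
  rw [Module.Basis.det_apply, Matrix.det_fin_two]
  simp [Module.Basis.toMatrix_apply, wedge]
  ring

theorem covolume_span_wedgeBasis (u v : Plane) (h : wedge u v ≠ 0) :
    ZLattice.covolume (Submodule.span ℤ (Set.range (wedgeBasis u v h))) =
      |wedge u v| * unitArea := by
  rw [ZLattice.covolume_eq_measure_fundamentalDomain _ volume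
    (ZSpan.isAddFundamentalDomain (wedgeBasis u v h) volume),
    volume_real_fundamentalDomain_wedgeBasis]

theorem mem_span_wedgeBasis {u v : Plane} {h : wedge u v ≠ 0} {x : Plane}
    (hx : x ∈ Submodule.span ℤ (Set.range (wedgeBasis u v h))) :
    ∃ m n : ℤ, x = (m : ℝ) • u + (n : ℝ) • v := by
  rw [coe_wedgeBasis, Matrix.range_cons, Matrix.range_cons, Matrix.range_empty, union_empty] at hx
  obtain ⟨m, n, hmn⟩ := Submodule.mem_span_pair.1 hx
  exact ⟨m, n, by rw [← hmn, Int.cast_smul_eq_zsmul, Int.cast_smul_eq_zsmul]⟩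

section Hexagon

variable {K : Set Plane} (hK : IsBody K) (hs : ∀ x ∈ K, -x ∈ K)
include hK

/-- The point `p` is the combination of `m p + n q` and `p - q` with weights `1 / (m + n)` and `n /
(m + n)`. The triangle inequality for the gauge then bounds the gauge of `m p + n q` below by `m`.
-/
theorem one_le_gauge_of_sector {p q : Plane} (hp : p ∈ frontier K) (hpq : p - q ∈ frontier K)
    {m n : ℤ} (hm : 1 ≤ m) (hn : 0 ≤ n) :
    1 ≤ gauge K ((m : ℝ) • p + (n : ℝ) • q) := by
  have hm' : (1 : ℝ) ≤ m := by exact_mod_cast hm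
  have hn' : (0 : ℝ) ≤ n := by exact_mod_cast hn
  have hd : 0 < (m : ℝ) + n := by linarith
  have h := hK.gauge_combo (a := 1 / ((m : ℝ) + n)) (b := n / ((m : ℝ) + n)) (by positivity)
    (by positivity) ((m : ℝ) • p + (n : ℝ) • q) (p - q)
  rw [show (1 / ((m : ℝ) + n)) • ((m : ℝ) • p + (n : ℝ) • q) + (n / ((m : ℝ) + n)) • (p - q) = p by
    match_scalars <;> field_simp; ring, hK.gauge_eq_one.2 hp, hK.gauge_eq_one.2 hpq] at h
  have h3 : 1 / ((m : ℝ) + n) * gauge K ((m : ℝ) • p + (n : ℝ) • q) + n / ((m : ℝ) + n) * 1 =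
    (gauge K ((m : ℝ) • p + (n : ℝ) • q) + n) / (m + n) := by ring
  rw [h3, le_div_iff₀ hd] at h
  linarith

include hs

/-- The half-plane `n ≥ 0` is covered by the three sectors spanned by consecutive vertices among
`u`, `v`, `v - u`, `-u`. -/
theorem IsInscribed.one_le_gauge_of_nonneg {u v : Plane} (h : IsInscribed K u v) {m n : ℤ}
    (hn : 0 ≤ n) (hmn : m ≠ 0 ∨ n ≠ 0) : 1 ≤ gauge K ((m : ℝ) • u + (n : ℝ) • v) := by
  have hnu := neg_mem_frontier hs h.left
  rcases le_or_gt 0 m with hm | hm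
  · rcases hm.eq_or_lt with rfl | hm
    · have := one_le_gauge_of_sector hK h.right h.sub (m := n) (n := 0) (by lia) le_rfl
      simpa using this
    · refine one_le_gauge_of_sector hK h.left ?_ (by lia) hn
      rw [show u - v = -(v - u) by abel]
      exact neg_mem_frontier hs h.sub
  rcases le_or_gt 0 (m + n) with h1 | h1
  · have := one_le_gauge_of_sector hK h.sub (q := v) (m := -m) (n := m + n)
      (by rwa [show v - u - v = -u by abel]) (by lia) h1
    convert this using 2
    push_cast
    module
  · have := one_le_gauge_of_sector hK hnu (q := v - u) (m := -m - n) (n := n)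
      (by rw [show -u - (v - u) = -v by abel]; exact neg_mem_frontier hs h.right) (by lia) hn
    convert this using 2
    push_cast
    module

theorem IsInscribed.one_le_gauge {u v : Plane} (h : IsInscribed K u v) {m n : ℤ}
    (hmn : m ≠ 0 ∨ n ≠ 0) : 1 ≤ gauge K ((m : ℝ) • u + (n : ℝ) • v) := by
  rcases le_or_gt 0 n with hn | hn
  · exact h.one_le_gauge_of_nonneg hK hs hn hmn
  · have := h.one_le_gauge_of_nonneg hK hs (m := -m) (n := -n) (by lia) (by lia)
    rw [← gauge_neg hs]
    convert this using 2
    push_cast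
    module

/-- The double of the lattice spanned by an inscribed affine-regular hexagon is a packing. -/
theorem IsInscribed.exists_isPacking {u v : Plane} (h : IsInscribed K u v) :
    ∃ (L : Submodule ℤ Plane) (_ : DiscreteTopology L) (_ : IsZLattice ℝ L),
      IsPacking L K ∧ ZLattice.covolume L = 4 * wedge u v * unitArea := by
  have hw : wedge ((2 : ℝ) • u) ((2 : ℝ) • v) = 4 * wedge u v := by
    rw [wedge_smul_left, wedge_smul_right]; ring
  have hne : wedge ((2 : ℝ) • u) ((2 : ℝ) • v) ≠ 0 := by
    rw [hw]; linarith [h.pos]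
  refine ⟨Submodule.span ℤ (Set.range (wedgeBasis _ _ hne)), inferInstance, inferInstance, ?_, ?_⟩
  · rw [isPacking_iff hK hs]
    intro x hx hx0
    obtain ⟨m, n, rfl⟩ := mem_span_wedgeBasis hx
    have hmn : m ≠ 0 ∨ n ≠ 0 := by
      by_contra! hc
      simp [hc.1, hc.2] at hx0
    have := h.one_le_gauge hK hs hmn
    rw [show (m : ℝ) • (2 : ℝ) • u + (n : ℝ) • (2 : ℝ) • v =
      (2 : ℝ) • ((m : ℝ) • u + (n : ℝ) • v) by module, IsBody.gauge_smul (by norm_num)]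
    linarith
  · rw [covolume_span_wedgeBasis, hw, abs_of_pos (by linarith [h.pos])]

omit hs in
theorem exists_gauge_minimal (L : Submodule ℤ Plane) [DiscreteTopology L] [IsZLattice ℝ L] :
    ∃ a ∈ L, a ≠ 0 ∧ ∀ x ∈ L, x ≠ 0 → gauge K a ≤ gauge K x := by
  obtain ⟨a₀, ha₀, ha₀0⟩ : ∃ a ∈ L, a ≠ 0 := by
    by_contra! hc
    have h1 := IsZLattice.span_top (K := ℝ) (L := L)
    have h2 : Submodule.span ℝ (L : Set Plane) ≤ ⊥ :=
      Submodule.span_le.2 fun x hx => by simpa using hc x hx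
    rw [h1] at h2
    have : (!₂[1, 0] : Plane) ∈ (⊥ : Submodule ℝ Plane) := h2 trivial
    rw [Submodule.mem_bot] at this
    have := congrArg (fun x : Plane => x 0) this
    simp at this
  have hbdd : Bornology.IsBounded {x | gauge K x ≤ gauge K a₀} := by
    have hr := hK.gauge_pos ha₀0
    refine (hK.isCompact.isBounded.smul₀ (gauge K a₀)).subset fun x hx => ?_
    refine ⟨(gauge K a₀)⁻¹ • x, hK.gauge_le_one.1 ?_, ?_⟩
    · rw [IsBody.gauge_smul (inv_nonneg.2 hr.le)]
      have hx' : gauge K x ≤ gauge K a₀ := hx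
      rw [inv_mul_le_iff₀ hr]
      linarith
    · simp [smul_smul, hr.ne']
  have hfin : ({x | gauge K x ≤ gauge K a₀} ∩ (L : Set Plane)).Finite := by
    refine Metric.finite_isBounded_inter_isClosed ?_ hbdd ?_
    · exact ⟨inferInstanceAs (DiscreteTopology L)⟩
    · exact AddSubgroup.isClosed_of_discrete (H := L.toAddSubgroup)
  have hfin2 : ({x | gauge K x ≤ gauge K a₀} ∩ ((L : Set Plane) \ {0})).Finite :=
    hfin.subset fun x hx => ⟨hx.1, hx.2.1⟩
  obtain ⟨a, ha, hmin⟩ := Set.exists_min_image _ (gauge K) hfin2 ⟨a₀, le_refl (gauge K a₀), ha₀, ha₀0⟩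
  refine ⟨a, ha.2.1, ha.2.2, fun x hx hx0 => ?_⟩
  rcases le_or_gt (gauge K x) (gauge K a₀) with h | h
  · exact hmin x ⟨h, hx, hx0⟩
  · exact le_trans ha.1 h.le

/-- The covolume of a packing lattice is at least that of the packing spanned by some inscribed
affine-regular hexagon. -/
theorem exists_isInscribed_le_covolume (L : Submodule ℤ Plane) [DiscreteTopology L]
    [IsZLattice ℝ L] (hL : IsPacking L K) :
    ∃ u v, IsInscribed K u v ∧ 4 * wedge u v * unitArea ≤ ZLattice.covolume L := by
  -- The hexagon is built on the direction of a shortest lattice vector `a`, scaled to the boundary.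
  -- Minkowski's pigeonhole argument will show that the covolume is at least the area of the
  -- parallelogram spanned by `g u = a` and `g v`, where `g ≥ 2`.
  obtain ⟨a, ha, ha0, hmin⟩ := exists_gauge_minimal hK L
  have hg := (isPacking_iff hK hs).1 hL a ha ha0
  set g := gauge K a with hgdef
  have hg0 : 0 < g := by linarith
  have hu : g⁻¹ • a ∈ frontier K := by
    rw [← hK.gauge_eq_one, IsBody.gauge_smul (inv_nonneg.2 hg0.le), inv_mul_cancel₀ hg0.ne']
  obtain ⟨v, h⟩ := exists_isInscribed hK hs hu
  set u := g⁻¹ • a with hudef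
  have hau : a = g • u := by rw [hudef, smul_smul, mul_inv_cancel₀ hg0.ne', one_smul]
  refine ⟨u, v, h, ?_⟩
  have hw : wedge (g • u) (g • v) = g ^ 2 * wedge u v := by
    rw [wedge_smul_left, wedge_smul_right]; ring
  have hwpos : 0 < wedge (g • u) (g • v) := by
    rw [hw]; have := h.pos; positivity
  set b := wedgeBasis (g • u) (g • v) hwpos.ne' with hb
  by_contra! hlt
  have hvol : ZLattice.covolume L < volume.real (ZSpan.fundamentalDomain b) := by
    rw [volume_real_fundamentalDomain_wedgeBasis, abs_of_pos hwpos, hw]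
    refine hlt.trans_le ?_
    have := unitArea_pos
    have := h.pos
    gcongr
    nlinarith
  have := ZLattice.module_free ℝ L
  have := ZLattice.module_finite ℝ L
  have hF := ZLattice.isAddFundamentalDomain (Module.Free.chooseBasis ℤ L) (volume : Measure Plane)
  set F := ZSpan.fundamentalDomain ((Module.Free.chooseBasis ℤ L).ofZLatticeBasis ℝ L)
  rw [ZLattice.covolume_eq_measure_fundamentalDomain L volume hF] at hvol
  have hvol' : volume F < volume (ZSpan.fundamentalDomain b) := by
    refine (ENNReal.toReal_lt_toReal ?_ (volume_fundamentalDomain_ne_top b)).1 hvol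
    exact (ZSpan.fundamentalDomain_isBounded _).measure_lt_top.ne
  have : MeasurableVAdd L Plane := inferInstanceAs (MeasurableVAdd L.toAddSubgroup Plane)
  have : VAddInvariantMeasure L Plane volume :=
    inferInstanceAs (VAddInvariantMeasure L.toAddSubgroup Plane volume)
  obtain ⟨x, y, hxy, hnd⟩ := exists_pair_mem_lattice_not_disjoint_vadd hF
    (ZSpan.fundamentalDomain_measurableSet b).nullMeasurableSet hvol'
  obtain ⟨z, hzx, hzy⟩ := Set.not_disjoint_iff.1 hnd
  obtain ⟨p, hp, hpz⟩ := Set.mem_vadd_set.1 hzx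
  obtain ⟨q, hq, hqz⟩ := Set.mem_vadd_set.1 hzy
  have hrep (p : Plane) : p = (b.repr p 0 * g) • u + (b.repr p 1 * g) • v := by
    conv_lhs => rw [← b.sum_repr p]
    rw [Fin.sum_univ_two, hb, coe_wedgeBasis]
    simp [smul_smul]
  rw [ZSpan.mem_fundamentalDomain] at hp hq
  -- lattice points close to the row of `a` vanish
  have key : ∀ s t : ℝ, |s| < 1 → 0 ≤ t → t < 1 → (s * g) • u + (t * g) • v ∈ L →
      t = 0 ∧ s = 0 := by
    intro s t hs1 ht0 ht1 hmem
    have hs1' := abs_lt.1 hs1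
    -- The rows of the open hexagon at height `t < 1` are longer than one, so subtracting `0` or `1`
    -- times `a` brings the point into the open hexagon scaled by `g`. There it would be shorter
    -- than `a`, hence it is zero.
    obtain ⟨k, hk1, hk2⟩ : ∃ k : ℤ, -1 < s - k ∧ s - k < 1 - t := by
      rcases lt_or_ge s (1 - t) with h1 | h1
      · exact ⟨0, by simpa using hs1'.1, by simpa using h1⟩
      · exact ⟨1, by push_cast; linarith, by push_cast; linarith⟩
    have hmem' : g • ((s - k) • u + t • v) ∈ L := by
      have h1 : (k : ℝ) • a ∈ L := by
        rw [Int.cast_smul_eq_zsmul]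
        exact L.smul_mem k ha
      have h2 := sub_mem hmem h1
      rw [hau] at h2
      convert h2 using 1
      module
    have hlt := h.gauge_lt hK hs hk1 ht0 hk2 ht1
    have h0 : g • ((s - k) • u + t • v) = 0 := by
      by_contra hne
      have h1 := hmin _ hmem' hne
      rw [IsBody.gauge_smul hg0.le] at h1
      nlinarith
    have h0' : (s - k) • u + t • v = 0 := by
      rcases smul_eq_zero.1 h0 with h | h
      · exact absurd h hg0.ne'
      · exact h
    have hli := LinearIndependent.pair_iff.1 (linearIndependent_of_wedge_ne_zero h.pos.ne') _ _ h0'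
    refine ⟨hli.2, ?_⟩
    have hsk : s = k := by linarith [hli.1]
    rw [hsk] at hs1 ⊢
    have : |k| < 1 := by exact_mod_cast hs1
    rw [Int.abs_lt_one_iff.1 this]
    simp
  have hsub : (y : Plane) - x = p - q := by
    have h1 : (x : Plane) + p = z := hpz
    have h2 : (y : Plane) + q = z := hqz
    rw [sub_eq_sub_iff_add_eq_add, h2, ← h1, add_comm]
  have hpq : p - q = ((b.repr p 0 - b.repr q 0) * g) • u + ((b.repr p 1 - b.repr q 1) * g) • v := by
    conv_lhs => rw [hrep p, hrep q]
    module
  have hLmem : p - q ∈ L := by rw [← hsub]; exact sub_mem y.2 x.2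
  have hzero : p - q = 0 := by
    have p0 := hp 0; have p1 := hp 1; have q0 := hq 0; have q1 := hq 1
    rcases le_or_gt 0 (b.repr p 1 - b.repr q 1) with ht | ht
    · obtain ⟨h1, h2⟩ := key _ _ (abs_lt.2 ⟨by linarith [p0.1, q0.2], by linarith [p0.2, q0.1]⟩) ht
        (by linarith [p1.2, q1.1]) (hpq ▸ hLmem)
      rw [hpq, h1, h2]; simp
    · have hLmem' : q - p ∈ L := by rw [← neg_sub]; exact neg_mem hLmem
      have hqp : q - p =
          ((b.repr q 0 - b.repr p 0) * g) • u + ((b.repr q 1 - b.repr p 1) * g) • v := by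
        rw [← neg_sub, hpq]; module
      obtain ⟨h1, h2⟩ := key _ _ (abs_lt.2 ⟨by linarith [p0.2, q0.1], by linarith [p0.1, q0.2]⟩)
        (by linarith) (by linarith [p1.1, q1.2]) (hqp ▸ hLmem')
      rw [← neg_sub, hqp, h1, h2]; simp
  exact hxy (Subtype.ext (sub_eq_zero.1 (hsub.trans hzero)).symm)

end Hexagon

/-- Packings have density at most one. -/
theorem bddAbove_latticeDensities {K : Set Plane} (hK : IsBody K) :
    BddAbove (latticeDensities K) := by
  refine ⟨1, ?_⟩
  rintro d ⟨L, _, _, hL, rfl⟩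
  refine (div_le_one (ZLattice.covolume_pos L volume)).2 ?_
  -- If the density exceeded one, two translates of the interior of `K` by lattice vectors would
  -- overlap, by the same pigeonhole principle.
  by_contra! hlt
  have := ZLattice.module_free ℝ L
  have := ZLattice.module_finite ℝ L
  have hF := ZLattice.isAddFundamentalDomain (Module.Free.chooseBasis ℤ L) (volume : Measure Plane)
  set F := ZSpan.fundamentalDomain ((Module.Free.chooseBasis ℤ L).ofZLatticeBasis ℝ L)
  rw [ZLattice.covolume_eq_measure_fundamentalDomain L volume hF] at hlt
  have hvol : volume F < volume (interior K) := by
    have h1 : volume (interior K) = volume K :=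
      measure_congr (interior_ae_eq_of_null_frontier (hK.convex.addHaar_frontier volume))
    rw [h1]
    exact (ENNReal.toReal_lt_toReal (ZSpan.fundamentalDomain_isBounded _).measure_lt_top.ne
      hK.isCompact.measure_lt_top.ne).1 hlt
  have : MeasurableVAdd L Plane := inferInstanceAs (MeasurableVAdd L.toAddSubgroup Plane)
  have : VAddInvariantMeasure L Plane volume :=
    inferInstanceAs (VAddInvariantMeasure L.toAddSubgroup Plane volume)
  obtain ⟨x, y, hxy, hnd⟩ := exists_pair_mem_lattice_not_disjoint_vadd hF
    isOpen_interior.measurableSet.nullMeasurableSet hvol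
  refine hnd ?_
  have := hL x.2 y.2 fun h => hxy (Subtype.ext h)
  simp only [Function.onFun, interior_vadd] at this
  exact this

/-! ### Strictly convex arcs -/

/-- A strictly convex arc on `[a, b]`, of class `C²` with derivatives `γ₁` and `γ₂`, that turns
counterclockwise around the origin. -/
structure IsArc (γ γ₁ γ₂ : ℝ → Plane) (a b : ℝ) : Prop where
  lt : a < b
  hasDerivAt : ∀ t ∈ Icc a b, HasDerivAt γ (γ₁ t) t
  hasDerivAt' : ∀ t ∈ Icc a b, HasDerivAt γ₁ (γ₂ t) t
  pos : ∀ s ∈ Icc a b, ∀ t ∈ Icc a b, 0 < wedge (γ s) (γ₁ t)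
  curved : ∀ s ∈ Icc a b, ∀ t ∈ Icc a b, 0 < wedge (γ₁ s) (γ₂ t)

/-- The convex cone with extreme rays through `p` and `q`. -/
def cone (p q : Plane) : Set Plane := {x | 0 ≤ wedge p x ∧ 0 ≤ wedge x q}

/-- The region swept by the segments from the origin to the points of a curve. -/
def sector (γ : ℝ → Plane) (a b : ℝ) : Set Plane :=
  {x | ∃ t ∈ Icc a b, ∃ c ∈ Icc (0 : ℝ) 1, x = c • γ t}

theorem isClosed_cone (p q : Plane) : IsClosed (cone p q) :=
  (isClosed_le continuous_const (continuous_const.wedge continuous_id)).inter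
    (isClosed_le continuous_const (continuous_id.wedge continuous_const))

theorem smul_mem_cone_iff {p q x : Plane} {c : ℝ} (hc : 0 < c) :
    c • x ∈ cone p q ↔ x ∈ cone p q := by
  simp [cone, wedge_smul_left, wedge_smul_right, hc]

theorem smul_mem_cone {p q x : Plane} {c : ℝ} (hc : 0 ≤ c) (hx : x ∈ cone p q) :
    c • x ∈ cone p q := by
  refine ⟨?_, ?_⟩
  · rw [wedge_smul_right]; exact mul_nonneg hc hx.1
  · rw [wedge_smul_left]; exact mul_nonneg hc hx.2

theorem eq_zero_of_mem_cone_of_neg {p q x : Plane} (h : 0 < wedge p q) (hx : x ∈ cone p q)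
    (hx' : -x ∈ cone p q) : x = 0 := by
  have h1 := hx'.1
  have h2 := hx'.2
  rw [wedge_neg_right] at h1
  rw [wedge_neg_left] at h2
  have h3 : wedge p x = 0 := le_antisymm (by linarith) hx.1
  have h4 : wedge x q = 0 := le_antisymm (by linarith) hx.2
  rw [eq_of_wedge_ne_zero h.ne' x, h3, h4]
  simp

namespace IsArc

variable {γ γ₁ γ₂ : ℝ → Plane} {a b : ℝ} (h : IsArc γ γ₁ γ₂ a b)
include h

theorem left_mem : a ∈ Icc a b := left_mem_Icc.2 h.lt.le

theorem right_mem : b ∈ Icc a b := right_mem_Icc.2 h.lt.le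

theorem continuousOn : ContinuousOn γ (Icc a b) :=
  fun t ht => (h.hasDerivAt t ht).continuousAt.continuousWithinAt

theorem continuousOn' : ContinuousOn γ₁ (Icc a b) :=
  fun t ht => (h.hasDerivAt' t ht).continuousAt.continuousWithinAt

theorem ne_zero {t : ℝ} (ht : t ∈ Icc a b) : γ t ≠ 0 :=
  ne_zero_of_wedge_left (h.pos t ht t ht).ne'

theorem strictMonoOn_wedge {s : ℝ} (hs : s ∈ Icc a b) :
    StrictMonoOn (fun t => wedge (γ s) (γ t)) (Icc a b) := by
  apply strictMonoOn_of_deriv_pos (convex_Icc a b) (continuousOn_const.wedge h.continuousOn)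
  intro t ht
  have ht := interior_subset ht
  rw [((h.hasDerivAt t ht).const_wedge (γ s)).deriv]
  exact h.pos s hs t ht

theorem strictMonoOn_wedge' {s : ℝ} (hs : s ∈ Icc a b) :
    StrictMonoOn (fun t => wedge (γ₁ s) (γ₁ t)) (Icc a b) := by
  apply strictMonoOn_of_deriv_pos (convex_Icc a b) (continuousOn_const.wedge h.continuousOn')
  intro t ht
  have ht := interior_subset ht
  rw [((h.hasDerivAt' t ht).const_wedge (γ₁ s)).deriv]
  exact h.curved s hs t ht

theorem wedge_pos {s t : ℝ} (hs : s ∈ Icc a b) (ht : t ∈ Icc a b) (hst : s < t) :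
    0 < wedge (γ s) (γ t) := by
  have := h.strictMonoOn_wedge hs hs ht hst
  simpa using this

theorem wedge_nonneg {s t : ℝ} (hs : s ∈ Icc a b) (ht : t ∈ Icc a b) (hst : s ≤ t) :
    0 ≤ wedge (γ s) (γ t) := by
  rcases hst.eq_or_lt with rfl | hst
  · simp
  · exact (h.wedge_pos hs ht hst).le

theorem wedge_ends_pos : 0 < wedge (γ a) (γ b) := h.wedge_pos h.left_mem h.right_mem h.lt

theorem mem_cone {t : ℝ} (ht : t ∈ Icc a b) : γ t ∈ cone (γ a) (γ b) :=
  ⟨h.wedge_nonneg h.left_mem ht ht.1, h.wedge_nonneg ht h.right_mem ht.2⟩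

/-- A strictly convex arc is on one side of its tangents. -/
theorem tangent_pos {s t : ℝ} (hs : s ∈ Icc a b) (ht : t ∈ Icc a b) (hst : s ≠ t) :
    0 < wedge (γ₁ t) (γ s - γ t) := by
  rw [wedge_sub_right, sub_pos]
  have hc : ContinuousOn (fun s => wedge (γ₁ t) (γ s)) (Icc a b) :=
    continuousOn_const.wedge h.continuousOn
  have hd : ∀ s ∈ Icc a b, deriv (fun s => wedge (γ₁ t) (γ s)) s = wedge (γ₁ t) (γ₁ s) :=
    fun s hs => ((h.hasDerivAt s hs).const_wedge (γ₁ t)).deriv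
  rcases hst.lt_or_gt with hst | hst
  · have hsub : Icc s t ⊆ Icc a b := Icc_subset_Icc hs.1 ht.2
    refine strictAntiOn_of_deriv_neg (convex_Icc s t) (hc.mono hsub) (fun r hr => ?_)
      (left_mem_Icc.2 hst.le) (right_mem_Icc.2 hst.le) hst
    rw [interior_Icc] at hr
    rw [hd r (hsub (Ioo_subset_Icc_self hr))]
    have := h.strictMonoOn_wedge' ht (hsub (Ioo_subset_Icc_self hr)) ht hr.2
    simpa using this
  · have hsub : Icc t s ⊆ Icc a b := Icc_subset_Icc ht.1 hs.2
    refine strictMonoOn_of_deriv_pos (convex_Icc t s) (hc.mono hsub) (fun r hr => ?_)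
      (left_mem_Icc.2 hst.le) (right_mem_Icc.2 hst.le) hst
    rw [interior_Icc] at hr
    rw [hd r (hsub (Ioo_subset_Icc_self hr))]
    have := h.strictMonoOn_wedge' ht ht (hsub (Ioo_subset_Icc_self hr)) hr.1
    simpa using this

theorem tangent_nonneg {s t : ℝ} (hs : s ∈ Icc a b) (ht : t ∈ Icc a b) :
    0 ≤ wedge (γ₁ t) (γ s - γ t) := by
  rcases eq_or_ne s t with rfl | hst
  · simp
  · exact (h.tangent_pos hs ht hst).le

/-- Rays in the cone are found on the arc by the intermediate value theorem, since the wedge product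
of `x` with the arc changes sign between its ends. -/
theorem exists_smul_eq {x : Plane} (hx : x ∈ cone (γ a) (γ b)) :
    ∃ t ∈ Icc a b, ∃ c : ℝ, 0 ≤ c ∧ x = c • γ t := by
  rcases eq_or_ne x 0 with rfl | hx0
  · exact ⟨a, h.left_mem, 0, le_rfl, by simp⟩
  have hc : ContinuousOn (fun t => wedge x (γ t)) (Icc a b) :=
    continuousOn_const.wedge h.continuousOn
  have h0 : (0 : ℝ) ∈ Icc (wedge x (γ a)) (wedge x (γ b)) :=
    ⟨by rw [wedge_swap]; linarith [hx.1], hx.2⟩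
  obtain ⟨t, ht, ht0⟩ := intermediate_value_Icc h.lt.le hc h0
  obtain ⟨c, hcx⟩ := exists_smul_eq_of_wedge_eq_zero (h.ne_zero ht)
    (by rw [wedge_swap]; simp only at ht0; rw [ht0, neg_zero] : wedge (γ t) x = 0)
  refine ⟨t, ht, c, ?_, hcx⟩
  by_contra! hneg
  refine hx0 (eq_zero_of_mem_cone_of_neg h.wedge_ends_pos hx ?_)
  rw [hcx, ← neg_smul]
  exact smul_mem_cone (by linarith) (h.mem_cone ht)

theorem sector_subset_cone : sector γ a b ⊆ cone (γ a) (γ b) := by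
  rintro x ⟨t, ht, c, hc, rfl⟩
  exact smul_mem_cone hc.1 (h.mem_cone ht)

/-! ### Replacement of an arc of the boundary of a convex body -/

/-- A point outside the cone of an arc, but on the inner side of the tangents at the ends, is on
the inner side of the chord. -/
theorem chord_lt {y : Plane} (ha : 0 ≤ wedge (γ₁ a) (y - γ a)) (hb : 0 ≤ wedge (γ₁ b) (y - γ b))
    (hy : y ∉ cone (γ a) (γ b)) :
    wedge y (γ b) + wedge (γ a) y < wedge (γ a) (γ b) := by
  -- By Cramer's rule the left side of the goal is `wedge (γ a) (γ b)` times the sum of the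
  -- coordinates of `y` in the basis of the end points, and the chord is where this sum is one.
  -- Pairing with the tangent at the end past which `y` lies bounds the sum.
  have e0 := congrArg (wedge (γ₁ a)) (wedge_smul_eq (γ a) (γ b) y)
  have e1 := congrArg (wedge (γ₁ b)) (wedge_smul_eq (γ a) (γ b) y)
  simp only [wedge_smul_right, wedge_add_right] at e0 e1
  have t0 := h.tangent_pos h.right_mem h.left_mem h.lt.ne'
  have t1 := h.tangent_pos h.left_mem h.right_mem h.lt.ne
  have p0 := h.pos a h.left_mem a h.left_mem
  have p1 := h.pos b h.right_mem b h.right_mem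
  rw [wedge_swap] at p0 p1
  have hD := h.wedge_ends_pos
  simp only [wedge_sub_right] at ha hb t0 t1
  have hy' : wedge (γ a) y < 0 ∨ wedge y (γ b) < 0 := by
    by_contra! hc
    exact hy hc
  by_contra! hle
  rcases hy' with hy' | hy'
  · nlinarith [mul_pos (neg_pos.2 hy') t0, mul_nonneg hD.le ha, mul_nonneg (sub_nonneg.2 hle) p0.le]
  · nlinarith [mul_pos (neg_pos.2 hy') t1, mul_nonneg hD.le hb, mul_nonneg (sub_nonneg.2 hle) p1.le]

/-- Both end points lie strictly inside the tangent at `t`, while `γ t` is on it. So the coordinates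
of `γ t` with respect to the end points have sum greater than one. -/
theorem chord_lt_arc {t : ℝ} (ht : t ∈ Ioo a b) :
    wedge (γ a) (γ b) < wedge (γ t) (γ b) + wedge (γ a) (γ t) := by
  have ht' := Ioo_subset_Icc_self ht
  have e := congrArg (wedge (γ₁ t)) (wedge_smul_eq (γ a) (γ b) (γ t))
  simp only [wedge_smul_right, wedge_add_right] at e
  have t0 := h.tangent_pos h.left_mem ht' ht.1.ne
  have t1 := h.tangent_pos h.right_mem ht' ht.2.ne'
  have p := h.pos t ht' t ht'
  rw [wedge_swap] at p
  have w0 := h.wedge_pos h.left_mem ht' ht.1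
  have w1 := h.wedge_pos ht' h.right_mem ht.2
  simp only [wedge_sub_right] at t0 t1
  by_contra! hle
  nlinarith [mul_pos w1 t0, mul_pos w0 t1, mul_nonneg (sub_nonneg.2 hle) p.le]

/-- The segment from an inner point to a point of the arc crosses the chord. -/
theorem exists_crossing {y : Plane} (ha : 0 ≤ wedge (γ₁ a) (y - γ a))
    (hb : 0 ≤ wedge (γ₁ b) (y - γ b)) (hy : y ∉ cone (γ a) (γ b)) {t : ℝ} (ht : t ∈ Ioo a b) :
    ∃ θ : ℝ, 0 < θ ∧ θ < 1 ∧ ∃ α β : ℝ, 0 ≤ α ∧ 0 ≤ β ∧ α + β = 1 ∧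
      θ • y + (1 - θ) • γ t = α • γ a + β • γ b := by
  have ht' := Ioo_subset_Icc_self ht
  have h1 := h.chord_lt ha hb hy
  have h2 := h.chord_lt_arc ht
  have hD := h.wedge_ends_pos
  set D := wedge (γ a) (γ b) with hDdef
  set m := γ t
  set ly := D - (wedge y (γ b) + wedge (γ a) y) with hly
  set lm := wedge m (γ b) + wedge (γ a) m - D with hlm
  have hly0 : 0 < ly := by linarith
  have hlm0 : 0 < lm := by linarith
  have hs : 0 < lm + ly := by linarith
  -- Up to a common factor, `ly` and `lm` are the distances of `y` and `γ t` from the chord line, on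
  -- opposite sides. The weight `θ` puts `z` on that line, and the two end tangents then confine `z`
  -- to the chord itself.
  set θ := lm / (lm + ly) with hθ
  have hθ0 : 0 < θ := div_pos hlm0 hs
  have hθ1 : θ < 1 := (div_lt_one hs).2 (by linarith)
  set z := θ • y + (1 - θ) • m with hz
  have hzeq := eq_of_wedge_ne_zero hD.ne' z
  set α := wedge z (γ b) / D with hα
  set β := wedge (γ a) z / D with hβ
  have hsum : α + β = 1 := by
    rw [hα, hβ, ← add_div, div_eq_one_iff_eq hD.ne']
    have e1 : wedge z (γ b) + wedge (γ a) z = θ * (D - ly) + (1 - θ) * (lm + D) := by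
      simp only [hz, wedge_add_left, wedge_add_right, wedge_smul_left, wedge_smul_right, hly, hlm]
      ring
    rw [e1]
    have e2 : θ * (lm + ly) = lm := div_mul_cancel₀ _ hs.ne'
    linear_combination -e2
  have tz {d c : Plane} (h1 : 0 ≤ wedge d (y - c)) (h2 : 0 ≤ wedge d (m - c)) :
      0 ≤ wedge d (z - c) := by
    have : wedge d (z - c) = θ * wedge d (y - c) + (1 - θ) * wedge d (m - c) := by
      simp only [hz, wedge_add_right, wedge_smul_right, wedge_sub_right]
      ring
    rw [this]
    have := mul_nonneg hθ0.le h1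
    have := mul_nonneg (sub_nonneg.2 hθ1.le) h2
    linarith
  have za := tz ha (h.tangent_nonneg ht' h.left_mem)
  have zb := tz hb (h.tangent_nonneg ht' h.right_mem)
  have t0 := h.tangent_pos h.right_mem h.left_mem h.lt.ne'
  have t1 := h.tangent_pos h.left_mem h.right_mem h.lt.ne
  rw [hzeq, show α • γ a + β • γ b - γ a = (α - 1) • γ a + β • γ b by module] at za
  rw [hzeq, show α • γ a + β • γ b - γ b = α • γ a + (β - 1) • γ b by module] at zb
  simp only [wedge_sub_right, wedge_add_right, wedge_smul_right] at za zb t0 t1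
  refine ⟨θ, hθ0, hθ1, α, β, ?_, ?_, hsum, hzeq⟩
  · have : 0 ≤ α * (wedge (γ₁ b) (γ a) - wedge (γ₁ b) (γ b)) := by
      have : β - 1 = -α := by linarith
      rw [this] at zb
      linarith
    exact nonneg_of_mul_nonneg_left this t1
  · have : 0 ≤ β * (wedge (γ₁ a) (γ b) - wedge (γ₁ a) (γ a)) := by
      have : α - 1 = -β := by linarith
      rw [this] at za
      linarith
    exact nonneg_of_mul_nonneg_left this t0

/-- On the line from `γ t` to `y`, the crossing with the chord is inside the tangent at `t`, and `γ
t` is on this tangent. So `y`, which lies beyond the crossing, is inside as well. -/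
theorem tangent_nonneg_of_notMem_cone {y : Plane} (ha : 0 ≤ wedge (γ₁ a) (y - γ a))
    (hb : 0 ≤ wedge (γ₁ b) (y - γ b)) (hy : y ∉ cone (γ a) (γ b)) {t : ℝ} (ht : t ∈ Icc a b) :
    0 ≤ wedge (γ₁ t) (y - γ t) := by
  rcases ht.1.eq_or_lt with rfl | hat
  · exact ha
  rcases ht.2.eq_or_lt with rfl | hbt
  · exact hb
  obtain ⟨θ, hθ0, -, α, β, hα, hβ, hαβ, hz⟩ := h.exists_crossing ha hb hy ⟨hat, hbt⟩
  have e : θ • (y - γ t) = α • (γ a - γ t) + β • (γ b - γ t) := by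
    have : θ • (y - γ t) = θ • y + (1 - θ) • γ t - (α + β) • γ t := by rw [hαβ]; module
    rw [this, hz]; module
  have e' := congrArg (wedge (γ₁ t)) e
  simp only [wedge_add_right, wedge_smul_right] at e'
  have h1 := mul_nonneg hα (h.tangent_nonneg h.left_mem ht)
  have h2 := mul_nonneg hβ (h.tangent_nonneg h.right_mem ht)
  exact nonneg_of_mul_nonneg_right (by rw [e']; linarith : 0 ≤ θ * wedge (γ₁ t) (y - γ t)) hθ0

/-- At the crossing with the chord `f` is at most `f y`, and the crossing lies between `y` and `γ
t`. Thus a support line of the old body at a boundary point outside the cone still supports the new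
body. -/
theorem functional_le {y : Plane} (ha : 0 ≤ wedge (γ₁ a) (y - γ a))
    (hb : 0 ≤ wedge (γ₁ b) (y - γ b)) (hy : y ∉ cone (γ a) (γ b)) {f : Plane →L[ℝ] ℝ}
    (fa : f (γ a) ≤ f y) (fb : f (γ b) ≤ f y) {t : ℝ} (ht : t ∈ Icc a b) : f (γ t) ≤ f y := by
  rcases ht.1.eq_or_lt with rfl | hat
  · exact fa
  rcases ht.2.eq_or_lt with rfl | hbt
  · exact fb
  obtain ⟨θ, -, hθ1, α, β, hα, hβ, hαβ, hz⟩ := h.exists_crossing ha hb hy ⟨hat, hbt⟩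
  have e := congrArg f hz
  simp only [map_add, map_smul, smul_eq_mul] at e
  have h1 := mul_le_mul_of_nonneg_left fa hα
  have h2 := mul_le_mul_of_nonneg_left fb hβ
  have h3 : α * f y + β * f y = f y := by rw [← add_mul, hαβ, one_mul]
  have h4 : (1 - θ) * f (γ t) ≤ (1 - θ) * f y := by linarith
  exact le_of_mul_le_mul_left h4 (by linarith)

end IsArc

theorem IsBody.exists_support {K : Set Plane} (hK : IsBody K) {y : Plane} (hy : y ∈ frontier K) :
    ∃ f : Plane →L[ℝ] ℝ, 0 < f y ∧ ∀ x ∈ K, f x ≤ f y := by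
  obtain ⟨f, hf⟩ := geometric_hahn_banach_open_point hK.convex.interior isOpen_interior hy.2
  have h0 : 0 < f y := by simpa using hf 0 hK.zero_mem
  refine ⟨f, h0, fun x hx => ?_⟩
  by_contra! hlt
  have hpos : 0 < f x := h0.trans hlt
  -- Shrinking `x` until `f` takes the value `f y` gives an interior point, where `f` must be
  -- strictly less than `f y`.
  have hlt1 : f y / f x < 1 := (div_lt_one hpos).2 hlt
  have hx' : (f y / f x) • x ∈ interior K := by
    rw [← hK.gauge_lt_one, IsBody.gauge_smul (by positivity)]
    have := hK.gauge_le_one.2 hx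
    have : 0 < f y / f x := by positivity
    nlinarith
  have := hf _ hx'
  rw [map_smul, smul_eq_mul, div_mul_cancel₀ _ hpos.ne'] at this
  exact lt_irrefl _ this

/-- A set is closed and convex if each point outside it is separated from it by a functional. -/
theorem convex_isClosed_of_separation {S : Set Plane}
    (h : ∀ x ∉ S, ∃ (f : Plane →L[ℝ] ℝ), ∃ c < f x, ∀ y ∈ S, f y ≤ c) :
    Convex ℝ S ∧ IsClosed S := by
  choose! f c hc hS using h
  have : S = ⋂ x ∈ Sᶜ, {y | f x y ≤ c x} := by
    ext y
    simp only [mem_iInter]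
    refine ⟨fun hy x hx => hS x hx y hy, fun hy => ?_⟩
    by_contra hyS
    exact absurd (hy y hyS) (not_le.2 (hc y hyS))
  rw [this]
  exact ⟨convex_iInter₂ fun x _ => convex_halfSpace_le (f x).toLinearMap.isLinear _,
    isClosed_biInter fun x _ => isClosed_le (f x).continuous continuous_const⟩

/-- The set `K`, with its part in the cone of a curve replaced by the sector of the curve. -/
def replaceArc (K : Set Plane) (γ : ℝ → Plane) (a b : ℝ) : Set Plane :=
  (K \ cone (γ a) (γ b)) ∪ sector γ a b

/-- The functional `wedge d`. -/
noncomputable def wedgeCLM (d : Plane) : Plane →L[ℝ] ℝ :=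
  d 0 • EuclideanSpace.proj 1 - d 1 • EuclideanSpace.proj 0

theorem wedgeCLM_apply (d x : Plane) : wedgeCLM d x = wedge d x := by
  simp [wedgeCLM, wedge]

section Replace

variable {K : Set Plane} (hK : IsBody K) {γ γ₁ γ₂ : ℝ → Plane} {a b : ℝ}
  (h : IsArc γ γ₁ γ₂ a b)
  (hKa : ∀ x ∈ K, 0 ≤ wedge (γ₁ a) (x - γ a)) (hKb : ∀ x ∈ K, 0 ≤ wedge (γ₁ b) (x - γ b))
include h

theorem mem_replaceArc_of_notMem_cone {x : Plane} (hx : x ∉ cone (γ a) (γ b)) :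
    x ∈ replaceArc K γ a b ↔ x ∈ K :=
  ⟨fun hx' => hx'.elim (fun h' => h'.1) fun h' => absurd (h.sector_subset_cone h') hx,
    fun hx' => Or.inl ⟨hx', hx⟩⟩

omit h in
theorem mem_replaceArc_of_mem_cone {x : Plane} (hx : x ∈ cone (γ a) (γ b)) :
    x ∈ replaceArc K γ a b ↔ x ∈ sector γ a b :=
  ⟨fun hx' => hx'.elim (fun h' => absurd hx h'.2) id, Or.inr⟩

include hKa hKb in
theorem tangent_nonneg_of_mem_replaceArc {y : Plane} (hy : y ∈ replaceArc K γ a b) {t : ℝ}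
    (ht : t ∈ Icc a b) : 0 ≤ wedge (γ₁ t) (y - γ t) := by
  rcases hy with hy | ⟨s, hs, c, hc, rfl⟩
  · exact h.tangent_nonneg_of_notMem_cone (hKa y hy.1) (hKb y hy.1) hy.2 ht
  · have e : wedge (γ₁ t) (c • γ s - γ t) =
        c * wedge (γ₁ t) (γ s - γ t) + (1 - c) * wedge (γ t) (γ₁ t) := by
      rw [wedge_swap (γ t)]
      simp only [wedge_sub_right, wedge_smul_right]
      ring
    rw [e]
    have := mul_nonneg hc.1 (h.tangent_nonneg hs ht)
    have := mul_nonneg (sub_nonneg.2 hc.2) (h.pos t ht t ht).le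
    linarith

include hK hKa hKb

/-- A point in the cone beyond the new arc is separated by the tangent at its radial projection. A
point outside the cone is separated by a support functional of `K` at its radial projection, which
`IsArc.functional_le` extends to the new arc. -/
theorem convex_isClosed_replaceArc (hpa : γ a ∈ K) (hpb : γ b ∈ K) :
    Convex ℝ (replaceArc K γ a b) ∧ IsClosed (replaceArc K γ a b) := by
  refine convex_isClosed_of_separation fun x hx => ?_
  by_cases hxc : x ∈ cone (γ a) (γ b)
  · rw [mem_replaceArc_of_mem_cone hxc] at hx
    obtain ⟨t, ht, c, hc, rfl⟩ := h.exists_smul_eq hxc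
    have hc1 : 1 < c := by
      by_contra! hc1
      exact hx ⟨t, ht, c, ⟨hc, hc1⟩, rfl⟩
    refine ⟨-wedgeCLM (γ₁ t), -wedge (γ₁ t) (γ t), ?_, fun y hy => ?_⟩
    · have := h.pos t ht t ht
      rw [wedge_swap] at this
      simp only [neg_apply, wedgeCLM_apply, wedge_smul_right]
      nlinarith
    · have := tangent_nonneg_of_mem_replaceArc h hKa hKb hy ht
      rw [wedge_sub_right] at this
      simp only [neg_apply, wedgeCLM_apply]
      linarith
  · rw [mem_replaceArc_of_notMem_cone h hxc] at hx
    obtain ⟨y, hy, μ, hμ, rfl⟩ := hK.exists_mem_frontier hx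
    rw [smul_mem_cone_iff (by linarith)] at hxc
    obtain ⟨f, hf0, hf⟩ := hK.exists_support hy
    have hyK := hK.frontier_subset hy
    refine ⟨f, f y, ?_, fun z hz => ?_⟩
    · rw [map_smul, smul_eq_mul]
      nlinarith
    · rcases hz with hz | ⟨t, ht, c, hc, rfl⟩
      · exact hf z hz.1
      · have := h.functional_le (hKa y hyK) (hKb y hyK) hxc (hf _ hpa) (hf _ hpb) ht
        rw [map_smul, smul_eq_mul]
        have h1 := mul_le_mul_of_nonneg_left this hc.1
        have h2 := mul_le_mul_of_nonneg_right hc.2 hf0.le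
        linarith

theorem isBody_replaceArc (hpa : γ a ∈ K) (hpb : γ b ∈ K) : IsBody (replaceArc K γ a b) := by
  obtain ⟨hconv, hclosed⟩ := convex_isClosed_replaceArc hK h hKa hKb hpa hpb
  refine ⟨hconv, ?_, ?_⟩
  · have hsec : sector γ a b ⊆ (fun p : ℝ × ℝ => p.2 • γ p.1) '' (Icc a b ×ˢ Icc 0 1) := by
      rintro x ⟨t, ht, c, hc, rfl⟩
      exact ⟨(t, c), ⟨ht, hc⟩, rfl⟩
    have hcomp : IsCompact ((fun p : ℝ × ℝ => p.2 • γ p.1) '' (Icc a b ×ˢ Icc 0 1)) := by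
      refine (isCompact_Icc.prod isCompact_Icc).image_of_continuousOn ?_
      exact continuousOn_snd.smul (h.continuousOn.comp continuousOn_fst fun p hp => hp.1)
    refine Metric.isCompact_of_isClosed_isBounded hclosed ?_
    exact (hK.isCompact.isBounded.subset sdiff_subset).union (hcomp.isBounded.subset hsec)
  · obtain ⟨t₀, ht₀, hmin⟩ := isCompact_Icc.exists_isMinOn ⟨a, h.left_mem⟩ h.continuousOn.norm
    have hr : 0 < ‖γ t₀‖ := norm_pos_iff.2 (h.ne_zero ht₀)
    rw [mem_interior_iff_mem_nhds]
    filter_upwards [hK.mem_nhds, Metric.ball_mem_nhds (0 : Plane) hr] with x hx hxr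
    by_cases hxc : x ∈ cone (γ a) (γ b)
    · obtain ⟨t, ht, c, hc, rfl⟩ := h.exists_smul_eq hxc
      refine Or.inr ⟨t, ht, c, ⟨hc, ?_⟩, rfl⟩
      rw [mem_ball_zero_iff, norm_smul, Real.norm_of_nonneg hc] at hxr
      have h1 : ‖γ t₀‖ ≤ ‖γ t‖ := hmin ht
      by_contra! hc1
      nlinarith
    · exact Or.inl ⟨hx, hxc⟩

omit hK in
-- Pushing `γ t` outward along its ray leaves the half-plane of the tangent at `t`, which contains
-- the whole body.
theorem mem_frontier_replaceArc {t : ℝ} (ht : t ∈ Icc a b) :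
    γ t ∈ frontier (replaceArc K γ a b) := by
  refine ⟨subset_closure (Or.inr ⟨t, ht, 1, by simp, by simp⟩), fun hint => ?_⟩
  have hev : ∀ᶠ c : ℝ in nhds 1, c • γ t ∈ interior (replaceArc K γ a b) := by
    have hc : ContinuousAt (fun c : ℝ => c • γ t) 1 := by fun_prop
    exact hc.eventually_mem (by rw [one_smul]; exact isOpen_interior.mem_nhds hint)
  obtain ⟨c, hc, hc1⟩ := ((hev.filter_mono nhdsWithin_le_nhds).and
    (self_mem_nhdsWithin : ∀ᶠ c : ℝ in nhdsWithin 1 (Ioi 1), c ∈ Ioi 1)).exists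
  have := tangent_nonneg_of_mem_replaceArc h hKa hKb (interior_subset hc) ht
  have hp := h.pos t ht t ht
  rw [wedge_swap] at hp
  rw [wedge_sub_right, wedge_smul_right] at this
  have hc1 : 1 < c := hc1
  nlinarith

theorem exists_eq_of_mem_frontier_replaceArc (hpa : γ a ∈ K) (hpb : γ b ∈ K) {y : Plane}
    (hy : y ∈ frontier (replaceArc K γ a b)) (hyc : y ∈ cone (γ a) (γ b)) :
    ∃ t ∈ Icc a b, y = γ t := by
  have hB := isBody_replaceArc hK h hKa hKb hpa hpb
  obtain ⟨t, ht, c, hc, rfl⟩ := (mem_replaceArc_of_mem_cone hyc).1 (hB.frontier_subset hy)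
  have ht' := mem_frontier_replaceArc h hKa hKb ht
  have h1 : ¬ c < 1 := by
    rw [← hB.smul_mem_interior_iff ht' hc.1]
    exact hy.2
  refine ⟨t, ht, ?_⟩
  rw [le_antisymm hc.2 (not_lt.1 h1), one_smul]

omit hK hKa hKb in
theorem mem_frontier_replaceArc_iff {y : Plane} (hy : y ∉ cone (γ a) (γ b)) :
    y ∈ frontier (replaceArc K γ a b) ↔ y ∈ frontier K := by
  have hev : ∀ᶠ x in nhds y, x ∈ replaceArc K γ a b ↔ x ∈ K := by
    filter_upwards [(isClosed_cone (γ a) (γ b)).isOpen_compl.mem_nhds hy] with x hx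
    exact mem_replaceArc_of_notMem_cone h hx
  have h1 : replaceArc K γ a b =ᶠ[nhds y] K := hev.mono fun x hx => propext hx
  simp only [frontier, mem_sdiff, mem_interior_iff_mem_nhds, mem_closure_iff_frequently]
  refine and_congr (Filter.frequently_congr hev) (not_congr ?_)
  exact Filter.eventually_congr hev

end Replace

/-! ### Area of a sector -/

/-- The coordinates of a point of the plane, as a measurable equivalence. -/
noncomputable def planeEquivProd : Plane ≃ᵐ ℝ × ℝ :=
  (MeasurableEquiv.toLp 2 (Fin 2 → ℝ)).symm.trans MeasurableEquiv.finTwoArrow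

theorem planeEquivProd_apply (x : Plane) : planeEquivProd x = (x 0, x 1) := rfl

theorem measurePreserving_planeEquivProd : MeasurePreserving planeEquivProd volume volume :=
  (volume_preserving_finTwoArrow ℝ).comp
    (EuclideanSpace.volume_preserving_symm_measurableEquiv_toLp (Fin 2))

namespace IsArc

variable {γ γ₁ γ₂ : ℝ → Plane} {a b : ℝ} (h : IsArc γ γ₁ γ₂ a b)
include h

theorem isCompact_sector : IsCompact (sector γ a b) := by
  have hsec : sector γ a b = (fun p : ℝ × ℝ => p.2 • γ p.1) '' (Icc a b ×ˢ Icc 0 1) := by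
    ext x
    constructor
    · rintro ⟨t, ht, c, hc, rfl⟩
      exact ⟨(t, c), ⟨ht, hc⟩, rfl⟩
    · rintro ⟨⟨t, c⟩, ⟨ht, hc⟩, rfl⟩
      exact ⟨t, ht, c, hc, rfl⟩
  rw [hsec]
  refine (isCompact_Icc.prod isCompact_Icc).image_of_continuousOn ?_
  exact continuousOn_snd.smul (h.continuousOn.comp continuousOn_fst fun p hp => hp.1)

theorem injOn_smul : InjOn (fun p : ℝ × ℝ => p.1 • γ p.2) (Ioc 0 1 ×ˢ Icc a b) := by
  have key : ∀ c ∈ Ioc (0 : ℝ) 1, ∀ c' ∈ Ioc (0 : ℝ) 1, ∀ s ∈ Icc a b, ∀ t ∈ Icc a b,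
      c • γ s = c' • γ t → ¬ s < t := by
    intro c hc c' hc' s hs t ht he hst
    have h1 := h.wedge_pos hs ht hst
    have h2 := congrArg (fun x => wedge x (γ t)) he
    simp only [wedge_smul_left, wedge_self, mul_zero] at h2
    have := mul_pos hc.1 h1
    linarith
  rintro ⟨c, s⟩ ⟨hc, hs⟩ ⟨c', t⟩ ⟨hc', ht⟩ he
  simp only at hc hs hc' ht he
  have hst : s = t := le_antisymm (not_lt.1 (key c' hc' c hc t ht s hs he.symm))
    (not_lt.1 (key c hc c' hc' s hs t ht he))
  subst hst
  have : (c - c') • γ s = 0 := by rw [sub_smul, he, sub_self]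
  rcases smul_eq_zero.1 this with h0 | h0
  · rw [sub_eq_zero.1 h0]
  · exact absurd h0 (h.ne_zero hs)

theorem volume_real_sector :
    volume.real (sector γ a b) = (1 / 2) * ∫ t in a..b, wedge (γ t) (γ₁ t) := by
  -- Polar coordinates `(c, t) ↦ c • γ t` have Jacobian `c * wedge (γ t) (γ₁ t)`. The value `c = 0`
  -- is excluded to make them injective, which costs only the origin.
  set S : Set (ℝ × ℝ) := Ioc (0 : ℝ) 1 ×ˢ Icc a b with hS
  have hSm : MeasurableSet S := measurableSet_Ioc.prod measurableSet_Icc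
  let ψ : ℝ × ℝ → ℝ × ℝ := fun p => (p.1 * γ p.2 0, p.1 * γ p.2 1)
  let ψ' : ℝ × ℝ → ℝ × ℝ →L[ℝ] ℝ × ℝ := fun p =>
    (Matrix.toLin (.finTwoProd ℝ) (.finTwoProd ℝ)
      !![γ p.2 0, p.1 * γ₁ p.2 0; γ p.2 1, p.1 * γ₁ p.2 1]).toContinuousLinearMap
  have hψ (p : ℝ × ℝ) : ψ p = planeEquivProd (p.1 • γ p.2) := by
    rw [planeEquivProd_apply]; rfl
  have hdet (p : ℝ × ℝ) : (ψ' p).det = p.1 * wedge (γ p.2) (γ₁ p.2) := by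
    simp only [ψ', ContinuousLinearMap.det, LinearMap.coe_toContinuousLinearMap,
      LinearMap.det_toLin, Matrix.det_fin_two_of, wedge]
    ring
  have hderiv : ∀ p ∈ S, HasFDerivWithinAt ψ (ψ' p) S p := by
    rintro ⟨c, t⟩ ⟨hc, ht⟩
    have hg (i : Fin 2) : HasFDerivAt (fun p : ℝ × ℝ => γ p.2 i)
        ((γ₁ t i) • ContinuousLinearMap.snd ℝ ℝ ℝ) (c, t) :=
      HasDerivAt.comp_hasFDerivAt (h₂ := fun s => γ s i) (f := Prod.snd) (c, t)
        ((h.hasDerivAt t ht).coord i) hasFDerivAt_snd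
    have hf (i : Fin 2) := (hasFDerivAt_fst (𝕜 := ℝ) (p := (c, t))).mul (hg i)
    refine HasFDerivAt.hasFDerivWithinAt ?_
    refine ((hf 0).prodMk (hf 1)).congr_fderiv ?_
    simp only [ψ', Matrix.toLin_finTwoProd_toContinuousLinearMap]
    ext <;> simp
  have hinj : InjOn ψ S := by
    intro p hp q hq he
    rw [hψ, hψ] at he
    exact h.injOn_smul hp hq (planeEquivProd.injective he)
  have himage : planeEquivProd ⁻¹' (ψ '' S) = sector γ a b \ {0} := by
    ext x
    constructor
    · rintro ⟨⟨c, t⟩, ⟨hc, ht⟩, he⟩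
      rw [hψ] at he
      have hx := planeEquivProd.injective he
      simp only at hx hc ht
      refine ⟨⟨t, ht, c, ⟨hc.1.le, hc.2⟩, hx.symm⟩, ?_⟩
      rw [← hx]
      exact smul_ne_zero hc.1.ne' (h.ne_zero ht)
    · rintro ⟨⟨t, ht, c, hc, rfl⟩, hx0⟩
      have hc0 : c ≠ 0 := by
        rintro rfl
        exact hx0 (by simp)
      exact ⟨(c, t), ⟨⟨hc.1.lt_of_ne hc0.symm, hc.2⟩, ht⟩, hψ _⟩
  have hvol : volume (sector γ a b) = volume (ψ '' S) := by
    rw [← measurePreserving_planeEquivProd.measure_preimage_equiv, himage,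
      measure_sdiff_null (measure_singleton _)]
  have hcont : ContinuousOn (fun t => wedge (γ t) (γ₁ t)) (Icc a b) :=
    h.continuousOn.wedge h.continuousOn'
  have hint : IntegrableOn (fun p : ℝ × ℝ => p.1 * wedge (γ p.2) (γ₁ p.2)) S volume := by
    refine IntegrableOn.mono_set (t := Icc (0 : ℝ) 1 ×ˢ Icc a b) ?_
      (prod_mono Ioc_subset_Icc_self subset_rfl)
    refine ContinuousOn.integrableOn_compact (isCompact_Icc.prod isCompact_Icc) ?_
    exact continuousOn_fst.mul (hcont.comp continuousOn_snd fun p hp => hp.2)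
  have hnn : ∀ p ∈ S, 0 ≤ p.1 * wedge (γ p.2) (γ₁ p.2) :=
    fun p hp => mul_nonneg hp.1.1.le (h.pos _ hp.2 _ hp.2).le
  have h1 : volume (ψ '' S) = ENNReal.ofReal (∫ p in S, p.1 * wedge (γ p.2) (γ₁ p.2)) := by
    rw [← lintegral_abs_det_fderiv_eq_addHaar_image volume hSm hderiv hinj,
      ofReal_integral_eq_lintegral_ofReal hint
        ((ae_restrict_iff' hSm).2 (Filter.Eventually.of_forall hnn))]
    refine setLIntegral_congr_fun hSm fun p hp => ?_
    rw [hdet, abs_of_nonneg (hnn p hp)]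
  rw [measureReal_def, hvol, h1, ENNReal.toReal_ofReal (setIntegral_nonneg hSm hnn), hS,
    Measure.volume_eq_prod,
    setIntegral_prod_mul (fun c : ℝ => c) (fun t => wedge (γ t) (γ₁ t)),
    ← intervalIntegral.integral_of_le zero_le_one, integral_id,
    intervalIntegral.integral_of_le h.lt.le, integral_Icc_eq_integral_Ioc]
  norm_num

end IsArc

/-- The change of area in the replacement of an arc `σ` of the boundary by an arc `γ` with the same
end points. -/
theorem volume_real_replaceArc {K : Set Plane} (hK : IsBody K) {σ σ₁ σ₂ γ γ₁ γ₂ : ℝ → Plane}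
    {a b : ℝ} (hσ : IsArc σ σ₁ σ₂ a b) (h : IsArc γ γ₁ γ₂ a b) (ha : γ a = σ a) (hb : γ b = σ b)
    (hσK : ∀ t ∈ Icc a b, σ t ∈ frontier K) :
    volume.real (replaceArc K γ a b) = volume.real K +
      (1 / 2) * ((∫ t in a..b, wedge (γ t) (γ₁ t)) - ∫ t in a..b, wedge (σ t) (σ₁ t)) := by
  have hKc : K ∩ cone (γ a) (γ b) = sector σ a b := by
    rw [ha, hb]
    ext x
    constructor
    · rintro ⟨hxK, hxc⟩
      obtain ⟨t, ht, c, hc, rfl⟩ := hσ.exists_smul_eq hxc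
      exact ⟨t, ht, c, ⟨hc, (hK.smul_mem_iff (hσK t ht) hc).1 hxK⟩, rfl⟩
    · intro hx
      refine ⟨?_, hσ.sector_subset_cone hx⟩
      obtain ⟨t, ht, c, hc, rfl⟩ := hx
      exact (hK.smul_mem_iff (hσK t ht) hc.1).2 hc.2
  have hfin : volume K ≠ ⊤ := hK.isCompact.measure_lt_top.ne
  have hcm := (isClosed_cone (γ a) (γ b)).measurableSet
  have h1 := measureReal_inter_add_sdiff (μ := (volume : Measure Plane)) (s := K) hcm hfin
  have h2 : volume.real (replaceArc K γ a b) =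
      volume.real (K \ cone (γ a) (γ b)) + volume.real (sector γ a b) := by
    refine measureReal_union ?_ h.isCompact_sector.isClosed.measurableSet ?_
      h.isCompact_sector.measure_lt_top.ne
    · exact Set.disjoint_left.2 fun x hx hx' => hx.2 (h.sector_subset_cone hx')
    · exact measure_ne_top_of_subset sdiff_subset hfin
  rw [hKc] at h1
  rw [h2, h.volume_real_sector, ← h1, hσ.volume_real_sector]
  ring

/-! ### Tangents of the boundary -/

/-- A regular curve in the boundary of a convex body is transversal to the radius, and its tangents
support the body. -/
theorem IsBody.tangent {K : Set Plane} (hK : IsBody K) {γ : ℝ → Plane} {d : Plane} {t : ℝ}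
    (hγ : HasDerivAt γ d t) (hfr : ∀ᶠ s in nhds t, γ s ∈ frontier K) (hd : d ≠ 0) :
    wedge (γ t) d ≠ 0 ∧ ∀ x ∈ K, 0 ≤ wedge (γ t) d * wedge d (x - γ t) := by
  obtain ⟨f, hf0, hf⟩ := hK.exists_support hfr.self_of_nhds
  have hder : HasDerivAt (fun s => f (γ s)) (f d) t := f.hasFDerivAt.comp_hasDerivAt t hγ
  -- A support functional at `γ t` is maximal along the curve, so it kills `d`. It is therefore a
  -- multiple of the wedge product with `d`, and the multiple is read off from Cramer's rule.
  have hmax : IsLocalMax (fun s => f (γ s)) t := hfr.mono fun s hs => hf _ (hK.frontier_subset hs)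
  have hfd : f d = 0 := hmax.hasDerivAt_eq_zero hder
  have hne : wedge (γ t) d ≠ 0 := by
    intro h0
    rw [wedge_swap, neg_eq_zero] at h0
    obtain ⟨c, hc⟩ := exists_smul_eq_of_wedge_eq_zero hd h0
    rw [hc, map_smul, hfd] at hf0
    simp at hf0
  refine ⟨hne, fun x hx => ?_⟩
  have e := congrArg f (wedge_smul_eq (γ t) d x)
  simp only [map_add, map_smul, smul_eq_mul, hfd, mul_zero, add_zero] at e
  have h1 := hf x hx
  rw [wedge_sub_right, wedge_swap d x, wedge_swap d (γ t)]
  by_contra! hlt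
  have h2 : 0 < f (γ t) * (wedge (γ t) d * (wedge x d - wedge (γ t) d)) := by
    refine mul_pos hf0 ?_
    linarith
  have h3 : f (γ t) * (wedge (γ t) d * (wedge x d - wedge (γ t) d)) =
      (wedge (γ t) d) ^ 2 * (f x - f (γ t)) := by
    linear_combination (-wedge (γ t) d) * e
  rw [h3] at h2
  have := mul_nonneg (sq_nonneg (wedge (γ t) d)) (sub_nonneg.2 h1)
  linarith

theorem IsBody.tangent_of_pos {K : Set Plane} (hK : IsBody K) {γ : ℝ → Plane} {d : Plane} {t : ℝ}
    (hγ : HasDerivAt γ d t) (hfr : ∀ᶠ s in nhds t, γ s ∈ frontier K) (hd : 0 < wedge (γ t) d)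
    {x : Plane} (hx : x ∈ K) : 0 ≤ wedge d (x - γ t) :=
  nonneg_of_mul_nonneg_right ((hK.tangent hγ hfr (ne_zero_of_wedge_right hd.ne')).2 x hx) hd

/-! ### Replacement of several arcs -/

/-- The arcs are replaced one at a time. The curve `σ i` on the larger open interval avoids the
cones of the other arcs, so earlier replacements leave it in the boundary and its end tangents still
support the current body. Agreement of first derivatives at the ends transfers these tangents to the
new arc. -/
theorem exists_replace_arcs {ι : Type*} [DecidableEq ι] {K : Set Plane} (hK : IsBody K)
    {σ σ₁ σ₂ γ γ₁ γ₂ : ι → ℝ → Plane} {a b a' b' : ℝ} (ha' : a' < a) (hb' : b < b')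
    (hσ : ∀ j, IsArc (σ j) (σ₁ j) (σ₂ j) a b) (hγ : ∀ j, IsArc (γ j) (γ₁ j) (γ₂ j) a b)
    (ea : ∀ j, γ j a = σ j a) (eb : ∀ j, γ j b = σ j b) (ea₁ : ∀ j, γ₁ j a = σ₁ j a)
    (eb₁ : ∀ j, γ₁ j b = σ₁ j b) (hfr : ∀ j, ∀ t ∈ Ioo a' b', σ j t ∈ frontier K)
    (hsep : ∀ i j, i ≠ j → ∀ t ∈ Ioo a' b', σ i t ∉ cone (σ j a) (σ j b)) (T : Finset ι) :
    ∃ K', IsBody K' ∧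
      (∀ y, (∀ j ∈ T, y ∉ cone (σ j a) (σ j b)) →
        ((y ∈ K' ↔ y ∈ K) ∧ (y ∈ frontier K' ↔ y ∈ frontier K))) ∧
      (∀ j ∈ T, ∀ y ∈ cone (σ j a) (σ j b),
        ((y ∈ K' ↔ y ∈ sector (γ j) a b) ∧ (y ∈ frontier K' ↔ ∃ t ∈ Icc a b, y = γ j t))) ∧
      volume.real K' = volume.real K + ∑ j ∈ T, (1 / 2) *
        ((∫ t in a..b, wedge (γ j t) (γ₁ j t)) - ∫ t in a..b, wedge (σ j t) (σ₁ j t)) := by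
  induction T using Finset.induction_on with
  | empty => exact ⟨K, hK, by simp, by simp, by simp⟩
  | insert i T hi ih =>
    obtain ⟨K₀, hK₀, hout, hin, hvol⟩ := ih
    have hIcc : Icc a b ⊆ Ioo a' b' := fun t ht => ⟨ha'.trans_le ht.1, ht.2.trans_lt hb'⟩
    have hfr₀ : ∀ t ∈ Ioo a' b', σ i t ∈ frontier K₀ := fun t ht =>
      ((hout _ fun j hj => hsep i j (fun h => hi (h ▸ hj)) t ht).2).2 (hfr i t ht)
    have hev : ∀ t ∈ Icc a b, ∀ᶠ s in nhds t, σ i s ∈ frontier K₀ := fun t ht =>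
      Filter.eventually_of_mem (isOpen_Ioo.mem_nhds (hIcc ht)) hfr₀
    have ham := (hσ i).left_mem
    have hbm := (hσ i).right_mem
    have hKa : ∀ x ∈ K₀, 0 ≤ wedge (γ₁ i a) (x - γ i a) := fun x hx => by
      rw [ea, ea₁]
      exact hK₀.tangent_of_pos ((hσ i).hasDerivAt a ham) (hev a ham) ((hσ i).pos a ham a ham) hx
    have hKb : ∀ x ∈ K₀, 0 ≤ wedge (γ₁ i b) (x - γ i b) := fun x hx => by
      rw [eb, eb₁]
      exact hK₀.tangent_of_pos ((hσ i).hasDerivAt b hbm) (hev b hbm) ((hσ i).pos b hbm b hbm) hx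
    have hpa : γ i a ∈ K₀ := by
      rw [ea]; exact hK₀.frontier_subset (hfr₀ a (hIcc ham))
    have hpb : γ i b ∈ K₀ := by
      rw [eb]; exact hK₀.frontier_subset (hfr₀ b (hIcc hbm))
    have hcone : cone (γ i a) (γ i b) = cone (σ i a) (σ i b) := by rw [ea, eb]
    have hB := isBody_replaceArc hK₀ (hγ i) hKa hKb hpa hpb
    have hdisj : ∀ j ∈ T, ∀ y ∈ cone (σ j a) (σ j b), y ∈ cone (σ i a) (σ i b) → y = 0 := by
      intro j hj y hyj hyi
      obtain ⟨t, ht, c, hc, rfl⟩ := (hσ i).exists_smul_eq hyi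
      rcases hc.eq_or_lt with rfl | hc
      · simp
      · rw [smul_mem_cone_iff hc] at hyj
        exact absurd hyj (hsep i j (fun h => hi (h ▸ hj)) t (hIcc ht))
    refine ⟨replaceArc K₀ (γ i) a b, hB, ?_, ?_, ?_⟩
    · intro y hy
      have hyi : y ∉ cone (γ i a) (γ i b) := by
        rw [hcone]; exact hy i (Finset.mem_insert_self _ _)
      have hyT := hout y fun j hj => hy j (Finset.mem_insert_of_mem hj)
      exact ⟨(mem_replaceArc_of_notMem_cone (hγ i) hyi).trans hyT.1,
        (mem_frontier_replaceArc_iff (hγ i) hyi).trans hyT.2⟩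
    · intro j hj y hy
      rcases Finset.mem_insert.1 hj with rfl | hj
      · rw [← hcone] at hy
        refine ⟨mem_replaceArc_of_mem_cone hy,
          fun h => exists_eq_of_mem_frontier_replaceArc hK₀ (hγ j) hKa hKb hpa hpb h hy, ?_⟩
        rintro ⟨t, ht, rfl⟩
        exact mem_frontier_replaceArc (hγ j) hKa hKb ht
      · rcases eq_or_ne y 0 with rfl | hy0
        · refine ⟨⟨fun _ => ⟨a, ham, 0, by simp, by simp⟩, fun _ => interior_subset hB.zero_mem⟩,
            fun h => absurd rfl (hB.ne_zero_of_mem_frontier h), ?_⟩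
          rintro ⟨t, ht, h0⟩
          exact absurd h0.symm ((hγ j).ne_zero ht)
        · have hyi : y ∉ cone (γ i a) (γ i b) := by
            rw [hcone]; exact fun h => hy0 (hdisj j hj y hy h)
          have hyT := hin j hj y hy
          exact ⟨(mem_replaceArc_of_notMem_cone (hγ i) hyi).trans hyT.1,
            (mem_frontier_replaceArc_iff (hγ i) hyi).trans hyT.2⟩
    · rw [volume_real_replaceArc hK₀ (hσ i) (hγ i) (ea i) (eb i)
        (fun t ht => hfr₀ t (hIcc ht)), hvol, Finset.sum_insert hi]
      ring

/-! ### Comparison of packing densities -/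

/-- A body of smaller area, whose inscribed affine-regular hexagons are not smaller, has smaller
lattice packing density. -/
theorem deltaLat_lt {K K' : Set Plane} (hK : IsBody K) (hs : ∀ x ∈ K, -x ∈ K) (hK' : IsBody K')
    (hs' : ∀ x ∈ K', -x ∈ K') (hvol : volume.real K' < volume.real K)
    (hex : ∀ u v, IsInscribed K' u v → ∃ u' v', IsInscribed K u' v' ∧ wedge u' v' ≤ wedge u v) :
    deltaLat K' < deltaLat K := by
  -- A packing lattice for `K'` need not pack `K`, but some packing lattice for `K` has no larger
  -- covolume. No smallest hexagon has to exist for this comparison.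
  have hpack : ∀ (L : Submodule ℤ Plane) (_ : DiscreteTopology L) (_ : IsZLattice ℝ L),
      IsPacking L K' →
      volume.real K / ZLattice.covolume L ≤ deltaLat K := by
    intro L _ _ hL
    obtain ⟨u, v, huv, hcov⟩ := exists_isInscribed_le_covolume hK' hs' L hL
    obtain ⟨u', v', huv', hle⟩ := hex u v huv
    obtain ⟨M, _, _, hM, hMcov⟩ := huv'.exists_isPacking hK hs
    have h1 : volume.real K / ZLattice.covolume M ≤ deltaLat K :=
      le_csSup (bddAbove_latticeDensities hK) ⟨M, ‹_›, ‹_›, hM, rfl⟩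
    refine le_trans ?_ h1
    have h2 : 0 < ZLattice.covolume M := ZLattice.covolume_pos M volume
    have h3 : ZLattice.covolume M ≤ ZLattice.covolume L := by
      refine le_trans ?_ hcov
      rw [hMcov]
      have := unitArea_pos
      gcongr
    gcongr
  have hVpos : 0 < volume.real K := by
    refine ENNReal.toReal_pos (fun h0 => ?_) hK.isCompact.measure_lt_top.ne
    have := measure_mono_null interior_subset h0
    exact (isOpen_interior.measure_ne_zero volume ⟨0, hK.zero_mem⟩) this
  have hδ : 0 < deltaLat K := by
    obtain ⟨y, hy⟩ : (frontier K).Nonempty := by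
      have : ∃ x, x ∉ K := by
        by_contra! hc
        have : K = univ := eq_univ_of_forall hc
        have hcomp := hK.isCompact
        rw [this] at hcomp
        exact noncompact_univ Plane hcomp
      obtain ⟨x, hx⟩ := this
      obtain ⟨y, hy, -⟩ := hK.exists_mem_frontier hx
      exact ⟨y, hy⟩
    obtain ⟨v, hv⟩ := exists_isInscribed hK hs hy
    obtain ⟨M, _, _, hM, hMcov⟩ := hv.exists_isPacking hK hs
    have h1 : volume.real K / ZLattice.covolume M ≤ deltaLat K :=
      le_csSup (bddAbove_latticeDensities hK) ⟨M, ‹_›, ‹_›, hM, rfl⟩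
    exact (div_pos hVpos (ZLattice.covolume_pos M volume)).trans_le h1
  have hle : deltaLat K' ≤ volume.real K' / volume.real K * deltaLat K := by
    refine Real.sSup_le ?_ (by positivity)
    rintro d ⟨L, _, _, hL, rfl⟩
    have h1 := hpack L ‹_› ‹_› hL
    have h2 : volume.real K' / ZLattice.covolume L volume =
        volume.real K' / volume.real K * (volume.real K / ZLattice.covolume L volume) := by
      field_simp
    rw [h2]
    gcongr
  refine hle.trans_lt ?_
  have : volume.real K' / volume.real K < 1 := (div_lt_one hVpos).2 hvol
  nlinarith

theorem deltaMin_le {K : Set Plane} (hK : IsCentrallySymmetricConvexDomain K) :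
    deltaMin ≤ deltaLat K := by
  refine csInf_le ⟨0, ?_⟩ ⟨K, hK, rfl⟩
  rintro _ ⟨K, -, rfl⟩
  refine Real.sSup_nonneg ?_
  rintro d ⟨L, _, _, -, rfl⟩
  exact div_nonneg measureReal_nonneg (ZLattice.covolume_pos L volume).le

theorem isPacking_vadd (L : Submodule ℤ Plane) (K : Set Plane) (c : Plane) :
    IsPacking L (c +ᵥ K) ↔ IsPacking L K := by
  have h (v : Plane) : interior (v +ᵥ (c +ᵥ K)) = c +ᵥ interior (v +ᵥ K) := by
    rw [vadd_comm, interior_vadd]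
  simp only [IsPacking, Set.PairwiseDisjoint, Set.Pairwise, Function.onFun, h,
    Set.disjoint_vadd_set]

theorem deltaLat_vadd (K : Set Plane) (c : Plane) : deltaLat (c +ᵥ K) = deltaLat K := by
  have h : volume.real (c +ᵥ K) = volume.real K := by
    rw [measureReal_def, measureReal_def, measure_vadd]
  simp only [deltaLat, latticeDensities, isPacking_vadd, h]

theorem IsBody.isDomain {K : Set Plane} (hK : IsBody K) (hs : ∀ x ∈ K, -x ∈ K) :
    IsCentrallySymmetricConvexDomain K :=
  ⟨hK.convex, hK.isCompact, ⟨0, hK.zero_mem⟩, 0, fun x hx => by simpa using hs x hx⟩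

theorem isBody_neg_vadd {K : Set Plane} (hK : IsCentrallySymmetricConvexDomain K) {c : Plane}
    (hc : IsCenter K c) : IsBody (-c +ᵥ K) ∧ ∀ x ∈ -c +ᵥ K, -x ∈ -c +ᵥ K := by
  have hs : ∀ x ∈ -c +ᵥ K, -x ∈ -c +ᵥ K := by
    rintro _ ⟨x, hx, rfl⟩
    refine ⟨_, hc x hx, ?_⟩
    simp only [vadd_eq_add]
    module
  have hconv : Convex ℝ (-c +ᵥ K) := hK.convex.vadd _
  refine ⟨⟨hconv, hK.isCompact.vadd _, ?_⟩, hs⟩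
  obtain ⟨x, hx⟩ := hK.nonempty_interior
  have hx1 : -c +ᵥ x ∈ interior (-c +ᵥ K) := by
    rw [interior_vadd]; exact Set.vadd_mem_vadd_set hx
  have hx2 := hs _ (interior_subset hx1)
  -- The origin is the midpoint of an interior point and its reflection.
  have := hconv.openSegment_interior_self_subset_interior hx1 hx2
  refine this ⟨2⁻¹, 2⁻¹, by norm_num, by norm_num, by norm_num, ?_⟩
  module

/-! ### Curves of inscribed hexagons -/

/-- A curve of affine-regular hexagons inscribed in `K`, of class `C²` with derivatives `τ₁` and
`τ₂`, with vertices of nonzero curvature. -/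
structure IsHexCurve (K : Set Plane) (τ τ₁ τ₂ : ZMod 6 → ℝ → Plane) (w a b : ℝ) : Prop where
  lt : a < b
  hasDerivAt : ∀ j, ∀ t ∈ Ioo a b, HasDerivAt (τ j) (τ₁ j t) t
  hasDerivAt' : ∀ j, ∀ t ∈ Ioo a b, HasDerivAt (τ₁ j) (τ₂ j t) t
  continuousOn : ∀ j, ContinuousOn (τ₂ j) (Ioo a b)
  sum_eq : ∀ j, ∀ t ∈ Ioo a b, τ j t + τ (j + 2) t + τ (j + 4) t = 0
  neg_eq : ∀ j, ∀ t ∈ Ioo a b, τ (j + 3) t = -τ j t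
  wedge_eq : ∀ j, ∀ t ∈ Ioo a b, wedge (τ j t) (τ (j + 2) t) = w
  pos : 0 < w
  mem_frontier : ∀ j, ∀ t ∈ Ioo a b, τ j t ∈ frontier K
  curved : ∀ j, ∀ t ∈ Ioo a b, wedge (τ₁ j t) (τ₂ j t) ≠ 0

namespace IsHexCurve

variable {K : Set Plane} {τ τ₁ τ₂ : ZMod 6 → ℝ → Plane} {w a b : ℝ}

/-- Time reversal changes the sign of `wedge (τ j) (τ₁ j)`, so it reduces clockwise motion to
counterclockwise motion. -/
theorem reverse (h : IsHexCurve K τ τ₁ τ₂ w a b) :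
    IsHexCurve K (fun j t => τ j (-t)) (fun j t => -τ₁ j (-t)) (fun j t => τ₂ j (-t)) w (-b) (-a) := by
  have hm {t : ℝ} (ht : t ∈ Ioo (-b) (-a)) : -t ∈ Ioo a b :=
    ⟨by linarith [ht.2], by linarith [ht.1]⟩
  refine ⟨by linarith [h.lt], ?_, ?_, ?_, fun j t ht => h.sum_eq j _ (hm ht),
    fun j t ht => h.neg_eq j _ (hm ht), fun j t ht => h.wedge_eq j _ (hm ht), h.pos,
    fun j t ht => h.mem_frontier j _ (hm ht), ?_⟩
  · intro j t ht
    have := (h.hasDerivAt j _ (hm ht)).scomp t (hasDerivAt_neg t)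
    simpa [Function.comp_def] using this
  · intro j t ht
    have := ((h.hasDerivAt' j _ (hm ht)).scomp t (hasDerivAt_neg t)).neg
    refine this.congr_deriv ?_
    simp
  · intro j
    exact (h.continuousOn j).comp continuousOn_neg fun t ht => hm ht
  · intro j t ht
    rw [wedge_neg_left]
    exact neg_ne_zero.2 (h.curved j _ (hm ht))

variable (h : IsHexCurve K τ τ₁ τ₂ w a b)
include h

theorem neg_deriv (j : ZMod 6) {t : ℝ} (ht : t ∈ Ioo a b) : τ₁ (j + 3) t = -τ₁ j t := by
  refine (h.hasDerivAt (j + 3) t ht).unique ((h.hasDerivAt j t ht).neg.congr_of_eventuallyEq ?_)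
  filter_upwards [isOpen_Ioo.mem_nhds ht] with s hs using h.neg_eq j s hs

theorem add_eq (j : ZMod 6) {t : ℝ} (ht : t ∈ Ioo a b) : τ (j + 1) t = τ j t + τ (j + 2) t := by
  have h1 := h.sum_eq j t ht
  have h2 := h.neg_eq (j + 1) t ht
  rw [show j + 1 + 3 = j + 4 by ring] at h2
  rw [h2] at h1
  rw [← sub_eq_zero, ← neg_eq_zero, ← h1]
  abel

theorem eventually_mem_frontier (j : ZMod 6) {t : ℝ} (ht : t ∈ Ioo a b) :
    ∀ᶠ s in nhds t, τ j s ∈ frontier K :=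
  Filter.eventually_of_mem (isOpen_Ioo.mem_nhds ht) fun s hs => h.mem_frontier j s hs

theorem deriv_ne_zero (j : ZMod 6) {t : ℝ} (ht : t ∈ Ioo a b) : τ₁ j t ≠ 0 :=
  ne_zero_of_wedge_left (h.curved j t ht)

/-- Write `B`, `C` for the wedge products of position and velocity at `j`, `j + 2`, and `A` for that
of the velocity at `j` with the position at `j + 2`. The tangents at these two vertices, tested on
the vertex `j + 1` between them, give `B A ≥ 0` and `C A ≥ 0`. If `B > 0 > C` then `A = 0`. The
tangent at the middle vertex then forces `B + C = 0`, against its transversality to the radius. -/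
theorem orientation_step (hK : IsBody K) (j : ZMod 6) {t : ℝ} (ht : t ∈ Ioo a b)
    (hpos : 0 < wedge (τ j t) (τ₁ j t)) : 0 < wedge (τ (j + 2) t) (τ₁ (j + 2) t) := by
  have tan (i : ZMod 6) := hK.tangent (h.hasDerivAt i t ht) (h.eventually_mem_frontier i ht)
    (h.deriv_ne_zero i ht)
  have hmem (i : ZMod 6) : τ i t ∈ K := hK.frontier_subset (h.mem_frontier i t ht)
  have e1 := h.add_eq j ht
  have e1' : τ₁ (j + 1) t = τ₁ j t + τ₁ (j + 2) t := by
    refine (h.hasDerivAt (j + 1) t ht).unique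
      (((h.hasDerivAt j t ht).add (h.hasDerivAt (j + 2) t ht)).congr_of_eventuallyEq ?_)
    filter_upwards [isOpen_Ioo.mem_nhds ht] with s hs using h.add_eq j hs
  have hw : wedge (τ₁ j t) (τ (j + 2) t) + wedge (τ j t) (τ₁ (j + 2) t) = 0 := by
    have d0 := h.hasDerivAt j t ht
    have d2 := h.hasDerivAt (j + 2) t ht
    have hd : HasDerivAt (fun s => wedge (τ j s) (τ (j + 2) s))
        (wedge (τ₁ j t) (τ (j + 2) t) + wedge (τ j t) (τ₁ (j + 2) t)) t := by
      refine (((d0.coord 0).mul (d2.coord 1)).sub ((d0.coord 1).mul (d2.coord 0))).congr_deriv ?_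
      simp only [wedge]
      ring
    refine hd.unique ((hasDerivAt_const t w).congr_of_eventuallyEq ?_)
    filter_upwards [isOpen_Ioo.mem_nhds ht] with s hs using h.wedge_eq j s hs
  have c0 := (tan j).2 _ (hmem (j + 1))
  have c2 := (tan (j + 2)).2 _ (hmem (j + 1))
  have c10 := (tan (j + 1)).2 _ (hmem j)
  have c12 := (tan (j + 1)).2 _ (hmem (j + 2))
  have n2 := (tan (j + 2)).1
  have n1 := (tan (j + 1)).1
  rw [e1, e1'] at c10 c12 n1
  rw [e1] at c0 c2
  set u := τ j t
  set v := τ (j + 2) t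
  set u' := τ₁ j t
  set v' := τ₁ (j + 2) t
  simp only [wedge_add_left, wedge_add_right, wedge_sub_right] at c0 c2 c10 c12 n1
  rw [wedge_swap u' u] at c0 c10 c12
  rw [wedge_swap v' u, wedge_swap v' v] at c2 c10 c12
  rw [wedge_swap v u'] at n1 c10 c12
  set A := wedge u' v
  have hA : wedge u v' = -A := by linarith
  rw [hA] at c2 c10 c12 n1
  set B := wedge u u'
  set C := wedge v v'
  have hA0 : 0 ≤ A := nonneg_of_mul_nonneg_right (by linarith : 0 ≤ B * A) hpos
  have hCA : 0 ≤ C * A := by linarith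
  by_contra! hC
  have hC' : C < 0 := lt_of_le_of_ne hC n2
  have hA1 : A = 0 := by nlinarith
  rw [hA1] at c10 c12 n1
  have c10' : 0 ≤ (B + C) * C := by linarith
  have c12' : 0 ≤ (B + C) * B := by linarith
  have h1 : 0 ≤ B + C := nonneg_of_mul_nonneg_left c12' hpos
  have h2 : B + C ≤ 0 := by nlinarith
  exact n1 (by linarith)

theorem orientation (hK : IsBody K) {t : ℝ} (ht : t ∈ Ioo a b)
    (hpos : 0 < wedge (τ 0 t) (τ₁ 0 t)) (j : ZMod 6) : 0 < wedge (τ j t) (τ₁ j t) := by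
  have step (j : ZMod 6) := h.orientation_step hK j ht
  have step3 (j : ZMod 6) (hj : 0 < wedge (τ j t) (τ₁ j t)) :
      0 < wedge (τ (j + 3) t) (τ₁ (j + 3) t) := by
    rwa [h.neg_eq j t ht, h.neg_deriv j ht, wedge_neg_left, wedge_neg_right, neg_neg]
  have h2 := step 0 hpos
  have h4 := step _ h2
  have h3 := step3 0 hpos
  have h5 := step3 _ h2
  have h1 := step3 _ h4
  fin_cases j
  · exact hpos
  · exact h1
  · exact h2
  · exact h3
  · exact h4
  · exact h5

/-- The tangent at `t` supports `K`, so `wedge (τ₁ j t) (τ j s)` is smallest at `s = t`. With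
negative curvature it would also have a local maximum there, hence be locally constant with
vanishing second derivative. -/
theorem curvature_pos (hK : IsBody K) (j : ZMod 6) {t : ℝ} (ht : t ∈ Ioo a b)
    (hpos : 0 < wedge (τ j t) (τ₁ j t)) : 0 < wedge (τ₁ j t) (τ₂ j t) := by
  by_contra! hle
  have hlt : wedge (τ₁ j t) (τ₂ j t) < 0 := lt_of_le_of_ne hle (h.curved j t ht)
  have hd : ∀ s ∈ Ioo a b, HasDerivAt (fun s => wedge (τ₁ j t) (τ j s)) (wedge (τ₁ j t) (τ₁ j s)) s :=
    fun s hs => (h.hasDerivAt j s hs).const_wedge _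
  have hev : ∀ᶠ s in nhds t, s ∈ Ioo a b := isOpen_Ioo.mem_nhds ht
  have hde : deriv (fun s => wedge (τ₁ j t) (τ j s)) =ᶠ[nhds t]
      fun s => wedge (τ₁ j t) (τ₁ j s) := hev.mono fun s hs => (hd s hs).deriv
  have hdd : deriv (deriv fun s => wedge (τ₁ j t) (τ j s)) t = wedge (τ₁ j t) (τ₂ j t) := by
    rw [hde.deriv_eq]
    exact ((h.hasDerivAt' j t ht).const_wedge _).deriv
  have hmax : IsLocalMax (fun s => wedge (τ₁ j t) (τ j s)) t := by
    refine isLocalMax_of_deriv_deriv_neg (by rw [hdd]; exact hlt) ?_ (hd t ht).continuousAt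
    rw [(hd t ht).deriv, wedge_self]
  have hconst : (fun s => wedge (τ₁ j t) (τ j s)) =ᶠ[nhds t] fun _ => wedge (τ₁ j t) (τ j t) := by
    filter_upwards [hmax, hev] with s hs1 hs2
    refine le_antisymm hs1 ?_
    have := hK.tangent_of_pos (h.hasDerivAt j t ht) (h.eventually_mem_frontier j ht) hpos
      (hK.frontier_subset (h.mem_frontier j s hs2))
    rw [wedge_sub_right] at this
    linarith
  have h0 : deriv (deriv fun s => wedge (τ₁ j t) (τ j s)) t = 0 := by
    rw [hconst.deriv.deriv_eq]
    simp
  rw [hdd] at h0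
  exact hlt.ne h0

end IsHexCurve

/-! ### Linear deformations of affine-regular hexagons -/

/-- Six vectors that form an affine-regular hexagon centered at the origin. -/
structure IsHex (U : ZMod 6 → Plane) : Prop where
  neg : ∀ j, U (j + 3) = -U j
  add : ∀ j, U (j + 1) = U j + U (j + 2)

/-- The image of a hexagon under the linear map with matrix `!![c + a, √3 β; √3 β, c - a]`, in the
frame in which the hexagon is regular. -/
def deform (c a β : ℝ) (U : ZMod 6 → Plane) (j : ZMod 6) : Plane :=
  c • U j + (a • U (-j) + β • (U (1 - j) + U (2 - j)))

namespace IsHex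

variable {U V : ZMod 6 → Plane} (hU : IsHex U) (hV : IsHex V)
include hU

theorem one : U 1 = U 0 + U 2 := hU.add 0

theorem three : U 3 = -U 0 := hU.neg 0

theorem four : U 4 = -U 0 - U 2 := by
  rw [show (4 : ZMod 6) = 1 + 3 from rfl, hU.neg, hU.one]; abel

theorem five : U 5 = -U 2 := hU.neg 2

/-- The relations of a hexagon are linear, and they are preserved by the reflections `j ↦ k - j` of
the indices. -/
theorem deform (c a β : ℝ) : IsHex (deform c a β U) := by
  have e3 (j : ZMod 6) : U (-(j + 3)) = -U (-j) := by
    rw [← hU.neg]; congr 1; revert j; decide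
  have e4 (j : ZMod 6) : U (1 - (j + 3)) = -U (1 - j) := by
    rw [← hU.neg]; congr 1; revert j; decide
  have e5 (j : ZMod 6) : U (2 - (j + 3)) = -U (2 - j) := by
    rw [← hU.neg]; congr 1; revert j; decide
  have f3 (j : ZMod 6) : U (-(j + 1)) = U (-j) + U (-(j + 2)) := by
    rw [show -(j + 1) = -(j + 2) + 1 by ring, hU.add, show -(j + 2) + 2 = -j by ring, add_comm]
  have f4 (j : ZMod 6) : U (1 - (j + 1)) = U (1 - j) + U (1 - (j + 2)) := by
    rw [show 1 - (j + 1) = 1 - (j + 2) + 1 by ring, hU.add,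
      show 1 - (j + 2) + 2 = 1 - j by ring, add_comm]
  have f5 (j : ZMod 6) : U (2 - (j + 1)) = U (2 - j) + U (2 - (j + 2)) := by
    rw [show 2 - (j + 1) = 2 - (j + 2) + 1 by ring, hU.add,
      show 2 - (j + 2) + 2 = 2 - j by ring, add_comm]
  refine ⟨fun j => ?_, fun j => ?_⟩
  · simp only [Reinhardt.deform, hU.neg, e3, e4, e5]
    module
  · simp only [Reinhardt.deform, hU.add, f3, f4, f5]
    module

theorem wedge_add_one (j : ZMod 6) : wedge (U j) (U (j + 1)) = wedge (U 0) (U 2) := by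
  have h0 : ∀ j, wedge (U (j + 1)) (U (j + 1 + 1)) = wedge (U j) (U (j + 1)) := by
    intro j
    have : U (j + 1 + 1) = U (j + 1) - U j := by
      rw [hU.add j, show j + 1 + 1 = j + 2 by ring]; abel
    rw [this, wedge_sub_right, wedge_self, wedge_swap _ (U j)]
    ring
  have b : wedge (U 0) (U (0 + 1)) = wedge (U 0) (U 2) := by
    rw [zero_add, hU.one, wedge_add_right, wedge_self, zero_add]
  fin_cases j
  · exact b
  · exact (h0 0).trans b
  · exact (h0 1).trans ((h0 0).trans b)
  · exact (h0 2).trans ((h0 1).trans ((h0 0).trans b))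
  · exact (h0 3).trans ((h0 2).trans ((h0 1).trans ((h0 0).trans b)))
  · exact (h0 4).trans ((h0 3).trans ((h0 2).trans ((h0 1).trans ((h0 0).trans b))))

/-- The factor is the determinant of the deformation; it will be one. -/
theorem wedge_deform (c a β : ℝ) :
    wedge (Reinhardt.deform c a β U 0) (Reinhardt.deform c a β U 2) =
      (c ^ 2 - a ^ 2 - 3 * β ^ 2) * wedge (U 0) (U 2) := by
  simp only [Reinhardt.deform, show (-0 : ZMod 6) = 0 from rfl, show (1 - 0 : ZMod 6) = 1 from rfl,
    show (2 - 0 : ZMod 6) = 2 from rfl, show (-2 : ZMod 6) = 4 from rfl,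
    show (1 - 2 : ZMod 6) = 5 from rfl, show (2 - 2 : ZMod 6) = 0 from rfl, hU.one, hU.four, hU.five]
  simp only [wedge, PiLp.add_apply, PiLp.smul_apply, PiLp.neg_apply, PiLp.sub_apply, smul_eq_mul]
  ring

include hV

/-- The sum of the area forms of a deformed hexagon. -/
theorem sum_wedge_deform (c a β c' a' β' : ℝ) :
    ∑ j, wedge (Reinhardt.deform c a β U j)
      (Reinhardt.deform c a β V j + Reinhardt.deform c' a' β' U j) =
    (c ^ 2 + a ^ 2 + 3 * β ^ 2) * ∑ j, wedge (U j) (V j) +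
    c * a * (4 * wedge (U 0) (V 0) - 4 * wedge (U 0) (V 2) - 4 * wedge (U 2) (V 0)
      - 8 * wedge (U 2) (V 2)) +
    12 * c * β * (wedge (U 0) (V 0) + wedge (U 0) (V 2) + wedge (U 2) (V 0)) +
    12 * (a * β' - a' * β) * wedge (U 0) (U 2) := by
  have six (f : ZMod 6 → ℝ) : ∑ j, f j = f 0 + f 1 + f 2 + f 3 + f 4 + f 5 :=
    Fin.sum_univ_six f
  rw [six, six]
  simp only [Reinhardt.deform, show (-0 : ZMod 6) = 0 from rfl, show (1 - 0 : ZMod 6) = 1 from rfl,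
    show (2 - 0 : ZMod 6) = 2 from rfl, show (-2 : ZMod 6) = 4 from rfl,
    show (1 - 2 : ZMod 6) = 5 from rfl, show (2 - 2 : ZMod 6) = 0 from rfl,
    show (-1 : ZMod 6) = 5 from rfl, show (1 - 1 : ZMod 6) = 0 from rfl,
    show (2 - 1 : ZMod 6) = 1 from rfl, show (-3 : ZMod 6) = 3 from rfl,
    show (1 - 3 : ZMod 6) = 4 from rfl, show (2 - 3 : ZMod 6) = 5 from rfl,
    show (-4 : ZMod 6) = 2 from rfl, show (1 - 4 : ZMod 6) = 3 from rfl,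
    show (2 - 4 : ZMod 6) = 4 from rfl, show (-5 : ZMod 6) = 1 from rfl,
    show (1 - 5 : ZMod 6) = 2 from rfl, show (2 - 5 : ZMod 6) = 3 from rfl,
    hU.one, hU.three, hU.four, hU.five, hV.one, hV.three, hV.four, hV.five]
  simp only [wedge, PiLp.add_apply, PiLp.smul_apply, PiLp.neg_apply, PiLp.sub_apply, smul_eq_mul]
  ring

/-- The first-order terms cancel in the sum of two opposite deformations. -/
theorem sum_wedge_deform_add {c a β c' a' β' : ℝ} (hdet : c ^ 2 - a ^ 2 - 3 * β ^ 2 = 1) :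
    ∑ j, wedge (Reinhardt.deform c a β U j)
      (Reinhardt.deform c a β V j + Reinhardt.deform c' a' β' U j) +
    ∑ j, wedge (Reinhardt.deform c (-a) (-β) U j)
      (Reinhardt.deform c (-a) (-β) V j + Reinhardt.deform c' (-a') (-β') U j) =
    2 * ∑ j, wedge (U j) (V j) + 4 * ((a ^ 2 + 3 * β ^ 2) * ∑ j, wedge (U j) (V j) +
      6 * (a * β' - a' * β) * wedge (U 0) (U 2)) := by
  rw [hU.sum_wedge_deform hV, hU.sum_wedge_deform hV]
  -- The terms in `c a` and `c β` are odd and cancel. The determinant condition turns `c² + a² +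
  -- 3β²` into `1 + 2 (a² + 3β²)`.
  linear_combination (2 * ∑ j, wedge (U j) (V j)) * hdet

end IsHex

/-! ### Families of curves of class `C²` -/

/-- A family of curves on an open set `S`, of class `C²` with derivatives `Φ₁` and `Φ₂` that depend
continuously on the parameter. -/
structure IsC2Family (Φ Φ₁ Φ₂ : ℝ → ℝ → Plane) (S : Set ℝ) : Prop where
  hasDerivAt : ∀ ε, ∀ t ∈ S, HasDerivAt (Φ ε) (Φ₁ ε t) t
  hasDerivAt' : ∀ ε, ∀ t ∈ S, HasDerivAt (Φ₁ ε) (Φ₂ ε t) t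
  continuousOn₀ : ContinuousOn (fun p : ℝ × ℝ => Φ p.1 p.2) (univ ×ˢ S)
  continuousOn₁ : ContinuousOn (fun p : ℝ × ℝ => Φ₁ p.1 p.2) (univ ×ˢ S)
  continuousOn₂ : ContinuousOn (fun p : ℝ × ℝ => Φ₂ p.1 p.2) (univ ×ˢ S)

/-- The partial derivative in the second variable. -/
noncomputable def partialDeriv (k : ℝ × ℝ → ℝ) (p : ℝ × ℝ) : ℝ := fderiv ℝ k p (0, 1)

theorem hasDerivAt_partialDeriv {k : ℝ × ℝ → ℝ} (hk : ContDiff ℝ 1 k) (ε t : ℝ) :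
    HasDerivAt (fun s => k (ε, s)) (partialDeriv k (ε, t)) t := by
  have h1 : HasFDerivAt k (fderiv ℝ k (ε, t)) (ε, t) :=
    (hk.differentiable one_ne_zero).differentiableAt.hasFDerivAt
  exact h1.comp_hasDerivAt t ((hasDerivAt_const t ε).prodMk (hasDerivAt_id t))

theorem contDiff_partialDeriv {k : ℝ × ℝ → ℝ} {n m : WithTop ℕ∞} (hk : ContDiff ℝ n k)
    (h : m + 1 ≤ n) : ContDiff ℝ m (partialDeriv k) :=
  (hk.fderiv_right h).clm_apply contDiff_const

namespace IsC2Family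

variable {Φ Φ₁ Φ₂ Ψ Ψ₁ Ψ₂ : ℝ → ℝ → Plane} {S : Set ℝ}

theorem add (hΦ : IsC2Family Φ Φ₁ Φ₂ S) (hΨ : IsC2Family Ψ Ψ₁ Ψ₂ S) :
    IsC2Family (fun ε t => Φ ε t + Ψ ε t) (fun ε t => Φ₁ ε t + Ψ₁ ε t)
      (fun ε t => Φ₂ ε t + Ψ₂ ε t) S :=
  ⟨fun ε t ht => (hΦ.hasDerivAt ε t ht).add (hΨ.hasDerivAt ε t ht),
    fun ε t ht => (hΦ.hasDerivAt' ε t ht).add (hΨ.hasDerivAt' ε t ht),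
    hΦ.continuousOn₀.add hΨ.continuousOn₀, hΦ.continuousOn₁.add hΨ.continuousOn₁,
    hΦ.continuousOn₂.add hΨ.continuousOn₂⟩

theorem smul (hΦ : IsC2Family Φ Φ₁ Φ₂ S) {k : ℝ × ℝ → ℝ} (hk : ContDiff ℝ 2 k) :
    IsC2Family (fun ε t => k (ε, t) • Φ ε t)
      (fun ε t => k (ε, t) • Φ₁ ε t + partialDeriv k (ε, t) • Φ ε t)
      (fun ε t => (k (ε, t) • Φ₂ ε t + partialDeriv k (ε, t) • Φ₁ ε t) +
        (partialDeriv k (ε, t) • Φ₁ ε t + partialDeriv (partialDeriv k) (ε, t) • Φ ε t)) S := by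
  have hk1 : ContDiff ℝ 1 (partialDeriv k) := contDiff_partialDeriv hk (by norm_num)
  have hk2 : ContDiff ℝ 0 (partialDeriv (partialDeriv k)) := contDiff_partialDeriv hk1 (by norm_num)
  have d0 (ε t : ℝ) := hasDerivAt_partialDeriv (hk.of_le (by norm_num)) ε t
  have d1 (ε t : ℝ) := hasDerivAt_partialDeriv hk1 ε t
  have c0 := hk.continuous.continuousOn (s := univ ×ˢ S)
  have c1 := hk1.continuous.continuousOn (s := univ ×ˢ S)
  have c2 := hk2.continuous.continuousOn (s := univ ×ˢ S)
  refine ⟨fun ε t ht => (d0 ε t).smul (hΦ.hasDerivAt ε t ht), fun ε t ht =>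
    ((d0 ε t).smul (hΦ.hasDerivAt' ε t ht)).add ((d1 ε t).smul (hΦ.hasDerivAt ε t ht)),
    c0.smul hΦ.continuousOn₀, (c0.smul hΦ.continuousOn₁).add (c1.smul hΦ.continuousOn₀), ?_⟩
  exact ((c0.smul hΦ.continuousOn₂).add (c1.smul hΦ.continuousOn₁)).add
    ((c1.smul hΦ.continuousOn₁).add (c2.smul hΦ.continuousOn₀))

theorem of_curve {τ τ₁ τ₂ : ℝ → Plane} (h : ∀ t ∈ S, HasDerivAt τ (τ₁ t) t)
    (h' : ∀ t ∈ S, HasDerivAt τ₁ (τ₂ t) t) (hc : ContinuousOn τ₂ S) :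
    IsC2Family (fun _ => τ) (fun _ => τ₁) (fun _ => τ₂) S := by
  have hmap : MapsTo (Prod.snd : ℝ × ℝ → ℝ) (univ ×ˢ S) S := fun p hp => hp.2
  refine ⟨fun _ => h, fun _ => h', ?_, ?_, hc.comp continuousOn_snd hmap⟩
  · exact ContinuousOn.comp (g := τ) (fun t ht => (h t ht).continuousAt.continuousWithinAt)
      continuousOn_snd hmap
  · exact ContinuousOn.comp (g := τ₁) (fun t ht => (h' t ht).continuousAt.continuousWithinAt)
      continuousOn_snd hmap

/-- The property of being a strictly convex arc is stable. -/
theorem eventually_isArc (hΦ : IsC2Family Φ Φ₁ Φ₂ S) (hS : IsOpen S) {a b : ℝ}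
    (hab : Icc a b ⊆ S) (h0 : IsArc (Φ 0) (Φ₁ 0) (Φ₂ 0) a b) :
    ∀ᶠ ε in nhds (0 : ℝ), IsArc (Φ ε) (Φ₁ ε) (Φ₂ ε) a b := by
  -- The inequalities that define an arc range over the compact square of pairs of times, so they
  -- persist for nearby parameters.
  have key {F G : ℝ → ℝ → Plane} (hF : ContinuousOn (fun p : ℝ × ℝ => F p.1 p.2) (univ ×ˢ S))
      (hG : ContinuousOn (fun p : ℝ × ℝ => G p.1 p.2) (univ ×ˢ S))
      (hpos : ∀ s ∈ Icc a b, ∀ t ∈ Icc a b, 0 < wedge (F 0 s) (G 0 t)) :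
      ∀ᶠ ε in nhds (0 : ℝ), ∀ s ∈ Icc a b, ∀ t ∈ Icc a b, 0 < wedge (F ε s) (G ε t) := by
    have hU : IsOpen (univ ×ˢ S : Set (ℝ × ℝ)) := isOpen_univ.prod hS
    have := (isCompact_Icc.prod isCompact_Icc : IsCompact (Icc a b ×ˢ Icc a b)).eventually_forall_of_forall_eventually
      (x₀ := (0 : ℝ)) (P := fun ε p => 0 < wedge (F ε p.1) (G ε p.2)) ?_
    · filter_upwards [this] with ε hε s hs t ht using hε (s, t) ⟨hs, ht⟩
    · rintro ⟨s, t⟩ ⟨hs, ht⟩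
      have hFc : ContinuousAt (fun q : ℝ × (ℝ × ℝ) => F q.1 q.2.1) (0, (s, t)) :=
        ContinuousAt.comp (g := fun p : ℝ × ℝ => F p.1 p.2)
          (f := fun q : ℝ × (ℝ × ℝ) => (q.1, q.2.1))
          (hF.continuousAt (hU.mem_nhds ⟨mem_univ _, hab hs⟩)) (by fun_prop)
      have hGc : ContinuousAt (fun q : ℝ × (ℝ × ℝ) => G q.1 q.2.2) (0, (s, t)) :=
        ContinuousAt.comp (g := fun p : ℝ × ℝ => G p.1 p.2)
          (f := fun q : ℝ × (ℝ × ℝ) => (q.1, q.2.2))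
          (hG.continuousAt (hU.mem_nhds ⟨mem_univ _, hab ht⟩)) (by fun_prop)
      exact (hFc.wedge hGc).eventually_mem (isOpen_Ioi.mem_nhds (hpos s hs t ht))
  filter_upwards [key hΦ.continuousOn₀ hΦ.continuousOn₁ h0.pos,
    key hΦ.continuousOn₁ hΦ.continuousOn₂ h0.curved] with ε h1 h2
  exact ⟨h0.lt, fun t ht => hΦ.hasDerivAt ε t (hab ht), fun t ht => hΦ.hasDerivAt' ε t (hab ht),
    h1, h2⟩

end IsC2Family

/-! ### Short arcs cut from a curve of hexagons. -/

namespace IsHexCurve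

variable {K : Set Plane} {τ τ₁ τ₂ : ZMod 6 → ℝ → Plane} {w a b : ℝ}

theorem continuousAt (h : IsHexCurve K τ τ₁ τ₂ w a b) (j : ZMod 6) {t : ℝ} (ht : t ∈ Ioo a b) :
    ContinuousAt (τ j) t :=
  (h.hasDerivAt j t ht).continuousAt

theorem continuousAt₁ (h : IsHexCurve K τ τ₁ τ₂ w a b) (j : ZMod 6) {t : ℝ} (ht : t ∈ Ioo a b) :
    ContinuousAt (τ₁ j) t :=
  (h.hasDerivAt' j t ht).continuousAt

theorem continuousAt₂ (h : IsHexCurve K τ τ₁ τ₂ w a b) (j : ZMod 6) {t : ℝ} (ht : t ∈ Ioo a b) :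
    ContinuousAt (τ₂ j) t :=
  (h.continuousOn j).continuousAt (isOpen_Ioo.mem_nhds ht)

theorem wedge_add_one (h : IsHexCurve K τ τ₁ τ₂ w a b) (j : ZMod 6) {t : ℝ} (ht : t ∈ Ioo a b) :
    wedge (τ j t) (τ (j + 1) t) = w := by
  rw [h.add_eq j ht, wedge_add_right, wedge_self, zero_add, h.wedge_eq j t ht]

theorem isHex (h : IsHexCurve K τ τ₁ τ₂ w a b) {t : ℝ} (ht : t ∈ Ioo a b) :
    IsHex fun j => τ j t :=
  ⟨fun j => h.neg_eq j t ht, fun j => h.add_eq j ht⟩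

theorem isHex_deriv (h : IsHexCurve K τ τ₁ τ₂ w a b) {t : ℝ} (ht : t ∈ Ioo a b) :
    IsHex fun j => τ₁ j t := by
  refine ⟨fun j => h.neg_deriv j ht, fun j => ?_⟩
  refine (h.hasDerivAt (j + 1) t ht).unique
    (((h.hasDerivAt j t ht).add (h.hasDerivAt (j + 2) t ht)).congr_of_eventuallyEq ?_)
  filter_upwards [isOpen_Ioo.mem_nhds ht] with s hs using h.add_eq j hs

/-- On a small interval around a time at which the curves turn counterclockwise, they are strictly
convex arcs, and the arcs are in separate cones. -/
theorem exists_arcs (h : IsHexCurve K τ τ₁ τ₂ w a b) (hK : IsBody K) {t₀ : ℝ} (ht₀ : t₀ ∈ Ioo a b)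
    (hpos : ∀ j, 0 < wedge (τ j t₀) (τ₁ j t₀)) :
    ∃ c' c d d', c' < c ∧ d < d' ∧ Ioo c' d' ⊆ Ioo a b ∧
      (∀ j, IsArc (τ j) (τ₁ j) (τ₂ j) c d) ∧
      ∀ j, ∀ s ∈ Ioo c' d', ∀ t ∈ Ioo c' d',
        0 < wedge (τ j s) (τ (j + 1) t) ∧ 0 < wedge (τ j s) (τ (j + 2) t) := by
  have key (F G : ℝ → Plane) (hF : ContinuousAt F t₀) (hG : ContinuousAt G t₀)
      (hFG : 0 < wedge (F t₀) (G t₀)) :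
      ∀ᶠ p : ℝ × ℝ in nhds (t₀, t₀), 0 < wedge (F p.1) (G p.2) := by
    have hFc : ContinuousAt (fun p : ℝ × ℝ => F p.1) (t₀, t₀) :=
      ContinuousAt.comp (g := F) hF continuousAt_fst
    have hGc : ContinuousAt (fun p : ℝ × ℝ => G p.2) (t₀, t₀) :=
      ContinuousAt.comp (g := G) hG continuousAt_snd
    exact (hFc.wedge hGc).eventually_mem (isOpen_Ioi.mem_nhds hFG)
  have hall : ∀ᶠ p : ℝ × ℝ in nhds t₀ ×ˢ nhds t₀, ∀ j,
      0 < wedge (τ j p.1) (τ₁ j p.2) ∧ 0 < wedge (τ₁ j p.1) (τ₂ j p.2) ∧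
      0 < wedge (τ j p.1) (τ (j + 1) p.2) ∧ 0 < wedge (τ j p.1) (τ (j + 2) p.2) := by
    rw [← nhds_prod_eq, Filter.eventually_all]
    intro j
    filter_upwards [key _ _ (h.continuousAt j ht₀) (h.continuousAt₁ j ht₀) (hpos j),
      key _ _ (h.continuousAt₁ j ht₀) (h.continuousAt₂ j ht₀) (h.curvature_pos hK j ht₀ (hpos j)),
      key _ _ (h.continuousAt j ht₀) (h.continuousAt (j + 1) ht₀)
        ((h.wedge_add_one j ht₀).symm ▸ h.pos),
      key _ _ (h.continuousAt j ht₀) (h.continuousAt (j + 2) ht₀)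
        ((h.wedge_eq j t₀ ht₀).symm ▸ h.pos)] with p h1 h2 h3 h4 using ⟨h1, h2, h3, h4⟩
  -- All the inequalities hold at the diagonal point `(t₀, t₀)` and are open, so they hold on a
  -- square around it.
  obtain ⟨U, hU, hUP⟩ := Filter.eventually_prod_self_iff'.1 hall
  obtain ⟨r, hr, hrU⟩ := Metric.mem_nhds_iff.1 (Filter.inter_mem hU (isOpen_Ioo.mem_nhds ht₀))
  rw [Real.ball_eq_Ioo] at hrU
  have hsub : Icc (t₀ - r / 2) (t₀ + r / 2) ⊆ Ioo (t₀ - r) (t₀ + r) :=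
    fun t ht => ⟨by linarith [ht.1], by linarith [ht.2]⟩
  have hUr {t : ℝ} (ht : t ∈ Ioo (t₀ - r) (t₀ + r)) : t ∈ U := (hrU ht).1
  have hIr {t : ℝ} (ht : t ∈ Ioo (t₀ - r) (t₀ + r)) : t ∈ Ioo a b := (hrU ht).2
  refine ⟨t₀ - r, t₀ - r / 2, t₀ + r / 2, t₀ + r, by linarith, by linarith, fun t ht => hIr ht,
    fun j => ⟨by linarith, fun t ht => h.hasDerivAt j t (hIr (hsub ht)),
      fun t ht => h.hasDerivAt' j t (hIr (hsub ht)), fun s hs t ht => ?_, fun s hs t ht => ?_⟩,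
    fun j s hs t ht => ?_⟩
  · exact (hUP s (hUr (hsub hs)) t (hUr (hsub ht)) j).1
  · exact (hUP s (hUr (hsub hs)) t (hUr (hsub ht)) j).2.1
  · exact (hUP s (hUr hs) t (hUr ht) j).2.2

end IsHexCurve

theorem zmod_six_eq_add (i j : ZMod 6) :
    i = j ∨ j = i + 1 ∨ j = i + 2 ∨ j = i + 3 ∨ i = j + 1 ∨ i = j + 2 := by
  revert i j; decide

/-- The cones of six arcs of a curve of hexagons are separate. -/
theorem notMem_cone_of_separated {τ : ZMod 6 → ℝ → Plane} {a a' b b' : ℝ} (hab : a < b)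
    (ha' : a' < a) (hb' : b < b') (hneg : ∀ j, ∀ t ∈ Ioo a' b', τ (j + 3) t = -τ j t)
    (hτ : ∀ j, ∀ s ∈ Ioo a' b', ∀ t ∈ Ioo a' b',
        0 < wedge (τ j s) (τ (j + 1) t) ∧ 0 < wedge (τ j s) (τ (j + 2) t))
    (harc : ∀ j, 0 < wedge (τ j a) (τ j b)) :
    ∀ i j, i ≠ j → ∀ t ∈ Ioo a' b', τ i t ∉ cone (τ j a) (τ j b) := by
  intro i j hij t ht hmem
  have ham : a ∈ Ioo a' b' := ⟨ha', by linarith⟩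
  have hbm : b ∈ Ioo a' b' := ⟨by linarith, hb'⟩
  obtain ⟨h1, h2⟩ := hmem
  rcases zmod_six_eq_add i j with h | h | h | h | h | h
  · exact hij h
  · have := (hτ i t ht a ham).1
    rw [← h, wedge_swap] at this
    linarith
  · have := (hτ i t ht a ham).2
    rw [← h, wedge_swap] at this
    linarith
  -- In the cone of the opposite arc, `τ i t` would have nonpositive coordinates in the basis `τ i
  -- a`, `τ i b`, so its wedge product with `τ (i + 1) a` could not be positive.
  · subst h
    have e := congrArg (fun x => wedge x (τ (i + 1) a)) (wedge_smul_eq (τ i a) (τ i b) (τ i t))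
    simp only [wedge_smul_left, wedge_add_left] at e
    rw [hneg i a ham, wedge_neg_left] at h1
    rw [hneg i b hbm, wedge_neg_right] at h2
    have p0 := (hτ i t ht a ham).1
    have pa := (hτ i a ham a ham).1
    have pb := (hτ i b hbm a ham).1
    have q1 := mul_pos (harc i) p0
    have q2 := mul_nonneg (by linarith : 0 ≤ -wedge (τ i a) (τ i t)) pb.le
    have q3 := mul_nonneg (by linarith : 0 ≤ -wedge (τ i t) (τ i b)) pa.le
    linarith
  · have := (hτ j b hbm t ht).1
    rw [← h, wedge_swap] at this
    linarith
  · have := (hτ j b hbm t ht).2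
    rw [← h, wedge_swap] at this
    linarith

/-! ### The oscillating deformation -/

/-- A function that vanishes to first order at `a` and `b`. -/
noncomputable def bump (a b t : ℝ) : ℝ := ((t - a) * (b - t)) ^ 2

/-- With `s = ε * bump a b t`, the three coefficients form the matrix `cosh s + sinh s · R(ωt) = exp
(s R(ωt))`, where `R(ωt)` is the reflection matrix of angle `ωt`. The division by `√3` in `coeffB`
offsets the factor `√3` in the matrix of `deform`. -/
noncomputable def coeffC (a b : ℝ) (p : ℝ × ℝ) : ℝ := Real.cosh (p.1 * bump a b p.2)

noncomputable def coeffA (a b ω : ℝ) (p : ℝ × ℝ) : ℝ :=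
  Real.sinh (p.1 * bump a b p.2) * Real.cos (ω * p.2)

noncomputable def coeffB (a b ω : ℝ) (p : ℝ × ℝ) : ℝ :=
  Real.sinh (p.1 * bump a b p.2) * Real.sin (ω * p.2) / √3

section Coeff

variable (a b ω : ℝ)

theorem contDiff_coeffC : ContDiff ℝ 2 (coeffC a b) := by
  unfold coeffC bump; fun_prop

theorem contDiff_coeffA : ContDiff ℝ 2 (coeffA a b ω) := by
  unfold coeffA bump; fun_prop

theorem contDiff_coeffB : ContDiff ℝ 2 (coeffB a b ω) := by
  unfold coeffB bump; fun_prop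

theorem coeff_det (p : ℝ × ℝ) :
    coeffC a b p ^ 2 - coeffA a b ω p ^ 2 - 3 * coeffB a b ω p ^ 2 = 1 := by
  have h3 : √3 ^ 2 = 3 := Real.sq_sqrt (by norm_num)
  simp only [coeffC, coeffA, coeffB, div_pow, mul_pow, h3, Real.cosh_sq]
  have := Real.sin_sq_add_cos_sq (ω * p.2)
  linear_combination (-Real.sinh (p.1 * bump a b p.2) ^ 2) * this

theorem coeff_sq (p : ℝ × ℝ) :
    coeffA a b ω p ^ 2 + 3 * coeffB a b ω p ^ 2 = Real.sinh (p.1 * bump a b p.2) ^ 2 := by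
  have h := coeff_det a b ω p
  simp only [coeffC, Real.cosh_sq] at h
  linarith

theorem hasDerivAt_bump (t : ℝ) :
    HasDerivAt (bump a b) (2 * ((t - a) * (b - t)) * ((b - t) - (t - a))) t := by
  have h := (((hasDerivAt_id t).sub_const a).mul ((hasDerivAt_const t b).sub (hasDerivAt_id t))).pow 2
  refine h.congr_deriv ?_
  simp only [Pi.mul_apply, Pi.sub_apply, id_eq, Nat.cast_ofNat, show (2 - 1 : ℕ) = 1 from rfl, pow_one]
  ring

theorem partialDeriv_eq_of_hasDerivAt {k : ℝ × ℝ → ℝ} (hk : ContDiff ℝ 2 k) {ε t k' : ℝ}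
    (h : HasDerivAt (fun s => k (ε, s)) k' t) : partialDeriv k (ε, t) = k' :=
  (hasDerivAt_partialDeriv (hk.of_le (by norm_num)) ε t).unique h

theorem partialDeriv_coeffC (ε t : ℝ) : partialDeriv (coeffC a b) (ε, t) =
    Real.sinh (ε * bump a b t) * (ε * (2 * ((t - a) * (b - t)) * ((b - t) - (t - a)))) :=
  partialDeriv_eq_of_hasDerivAt (contDiff_coeffC a b) ((hasDerivAt_bump a b t).const_mul ε).cosh

theorem partialDeriv_coeffA (ε t : ℝ) : partialDeriv (coeffA a b ω) (ε, t) =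
    Real.cosh (ε * bump a b t) * (ε * (2 * ((t - a) * (b - t)) * ((b - t) - (t - a)))) *
      Real.cos (ω * t) + Real.sinh (ε * bump a b t) * (-Real.sin (ω * t) * ω) := by
  refine partialDeriv_eq_of_hasDerivAt (contDiff_coeffA a b ω) ?_
  have := ((hasDerivAt_bump a b t).const_mul ε).sinh.mul ((hasDerivAt_id t).const_mul ω).cos
  refine this.congr_deriv ?_
  simp

theorem partialDeriv_coeffB (ε t : ℝ) : partialDeriv (coeffB a b ω) (ε, t) =
    (Real.cosh (ε * bump a b t) * (ε * (2 * ((t - a) * (b - t)) * ((b - t) - (t - a)))) *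
      Real.sin (ω * t) + Real.sinh (ε * bump a b t) * (Real.cos (ω * t) * ω)) / √3 := by
  refine partialDeriv_eq_of_hasDerivAt (contDiff_coeffB a b ω) ?_
  have := (((hasDerivAt_bump a b t).const_mul ε).sinh.mul
    ((hasDerivAt_id t).const_mul ω).sin).div_const √3
  refine this.congr_deriv ?_
  simp

/-- The vector `(a, √3 β)` has length `|sinh|` and turns with angular velocity `ω`, so the
derivative of the bump drops out. This term is linear in `ω` and can be made to dominate. -/
theorem coeff_rotation (ε t : ℝ) :
    coeffA a b ω (ε, t) * partialDeriv (coeffB a b ω) (ε, t) -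
      partialDeriv (coeffA a b ω) (ε, t) * coeffB a b ω (ε, t) =
    Real.sinh (ε * bump a b t) ^ 2 * (ω / √3) := by
  rw [partialDeriv_coeffA, partialDeriv_coeffB]
  simp only [coeffA, coeffB]
  have := Real.sin_sq_add_cos_sq (ω * t)
  linear_combination (Real.sinh (ε * bump a b t) ^ 2 * (ω / √3)) * this

end Coeff

/-- The deformed curve of hexagons. -/
noncomputable def deformCurve (τ : ZMod 6 → ℝ → Plane) (a b ω ε : ℝ) (j : ZMod 6) (t : ℝ) : Plane :=
  deform (coeffC a b (ε, t)) (coeffA a b ω (ε, t)) (coeffB a b ω (ε, t)) (fun i => τ i t) j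

/-- The derivative of the deformed curve of hexagons. -/
noncomputable def deformCurve' (τ τ₁ : ZMod 6 → ℝ → Plane) (a b ω ε : ℝ) (j : ZMod 6) (t : ℝ) :
    Plane :=
  deform (coeffC a b (ε, t)) (coeffA a b ω (ε, t)) (coeffB a b ω (ε, t)) (fun i => τ₁ i t) j +
    deform (partialDeriv (coeffC a b) (ε, t)) (partialDeriv (coeffA a b ω) (ε, t))
      (partialDeriv (coeffB a b ω) (ε, t)) (fun i => τ i t) j

theorem deform_one_zero_zero (U : ZMod 6 → Plane) (j : ZMod 6) : deform 1 0 0 U j = U j := by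
  simp [deform]

theorem deform_zero_zero_zero (U : ZMod 6 → Plane) (j : ZMod 6) : deform 0 0 0 U j = 0 := by
  simp [deform]

section DeformCurve

variable (τ τ₁ : ZMod 6 → ℝ → Plane) (a b ω : ℝ) (j : ZMod 6)

theorem deformCurve_zero (t : ℝ) : deformCurve τ a b ω 0 j t = τ j t := by
  simp [deformCurve, coeffC, coeffA, coeffB, deform_one_zero_zero]

theorem deformCurve'_zero (t : ℝ) : deformCurve' τ τ₁ a b ω 0 j t = τ₁ j t := by
  simp [deformCurve', partialDeriv_coeffC, partialDeriv_coeffA, partialDeriv_coeffB, coeffC, coeffA,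
    coeffB, deform_one_zero_zero, deform_zero_zero_zero]

theorem deformCurve_left (ε : ℝ) : deformCurve τ a b ω ε j a = τ j a := by
  simp [deformCurve, coeffC, coeffA, coeffB, bump, deform_one_zero_zero]

theorem deformCurve_right (ε : ℝ) : deformCurve τ a b ω ε j b = τ j b := by
  simp [deformCurve, coeffC, coeffA, coeffB, bump, deform_one_zero_zero]

theorem deformCurve'_left (ε : ℝ) : deformCurve' τ τ₁ a b ω ε j a = τ₁ j a := by
  simp [deformCurve', partialDeriv_coeffC, partialDeriv_coeffA, partialDeriv_coeffB, coeffC, coeffA,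
    coeffB, bump, deform_one_zero_zero, deform_zero_zero_zero]

theorem deformCurve'_right (ε : ℝ) : deformCurve' τ τ₁ a b ω ε j b = τ₁ j b := by
  simp [deformCurve', partialDeriv_coeffC, partialDeriv_coeffA, partialDeriv_coeffB, coeffC, coeffA,
    coeffB, bump, deform_one_zero_zero, deform_zero_zero_zero]

/-- The second derivative is left unspecified: only its existence and joint continuity matter. -/
theorem exists_isC2Family {τ τ₁ τ₂ : ZMod 6 → ℝ → Plane} {S : Set ℝ}
    (h : ∀ i, ∀ t ∈ S, HasDerivAt (τ i) (τ₁ i t) t)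
    (h' : ∀ i, ∀ t ∈ S, HasDerivAt (τ₁ i) (τ₂ i t) t) (hc : ∀ i, ContinuousOn (τ₂ i) S) :
    ∃ Φ₂, IsC2Family (fun ε => deformCurve τ a b ω ε j) (fun ε => deformCurve' τ τ₁ a b ω ε j) Φ₂
      S := by
  have f (i : ZMod 6) := IsC2Family.of_curve (h i) (h' i) (hc i)
  have := ((f j).smul (contDiff_coeffC a b)).add (((f (-j)).smul (contDiff_coeffA a b ω)).add
    (((f (1 - j)).add (f (2 - j))).smul (contDiff_coeffB a b ω)))
  rw [show (fun ε => deformCurve' τ τ₁ a b ω ε j) = _ by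
    funext ε t
    rw [deformCurve', deform, deform, add_add_add_comm, add_add_add_comm (_ • τ₁ (-j) t)]]
  exact ⟨_, this⟩

end DeformCurve

theorem neg_mem_cone {p q x : Plane} (hx : x ∈ cone p q) : -x ∈ cone (-p) (-q) := by
  simpa [cone, wedge_neg_left, wedge_neg_right] using hx

theorem IsArc.intervalIntegrable {γ γ₁ γ₂ : ℝ → Plane} {a b : ℝ} (h : IsArc γ γ₁ γ₂ a b) :
    IntervalIntegrable (fun t => wedge (γ t) (γ₁ t)) volume a b :=
  (h.continuousOn.wedge h.continuousOn').intervalIntegrable_of_Icc h.lt.le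

/-- In `ε`, the coefficient `coeffC` is even and the other two are odd, so `ε` and `-ε` give
opposite deformations and their first-order effects cancel. -/
theorem sum_wedge_deformCurve_add {τ τ₁ : ZMod 6 → ℝ → Plane} {t : ℝ} (hU : IsHex fun j => τ j t)
    (hV : IsHex fun j => τ₁ j t) (a b ω ε : ℝ) :
    ∑ j, wedge (deformCurve τ a b ω ε j t) (deformCurve' τ τ₁ a b ω ε j t) +
      ∑ j, wedge (deformCurve τ a b ω (-ε) j t) (deformCurve' τ τ₁ a b ω (-ε) j t) =
    2 * ∑ j, wedge (τ j t) (τ₁ j t) + 4 * (Real.sinh (ε * bump a b t) ^ 2 *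
      (∑ j, wedge (τ j t) (τ₁ j t) + 6 * ω / √3 * wedge (τ 0 t) (τ 2 t))) := by
  have h := hU.sum_wedge_deform_add hV (c' := partialDeriv (coeffC a b) (ε, t))
    (a' := partialDeriv (coeffA a b ω) (ε, t)) (β' := partialDeriv (coeffB a b ω) (ε, t))
    (coeff_det a b ω (ε, t))
  rw [coeff_sq, coeff_rotation] at h
  have e1 : coeffC a b (-ε, t) = coeffC a b (ε, t) := by simp [coeffC]
  have e2 : coeffA a b ω (-ε, t) = -coeffA a b ω (ε, t) := by simp [coeffA]
  have e3 : coeffB a b ω (-ε, t) = -coeffB a b ω (ε, t) := by simp [coeffB, neg_div]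
  have e4 : partialDeriv (coeffC a b) (-ε, t) = partialDeriv (coeffC a b) (ε, t) := by
    simp [partialDeriv_coeffC]
  have e5 : partialDeriv (coeffA a b ω) (-ε, t) = -partialDeriv (coeffA a b ω) (ε, t) := by
    simp only [partialDeriv_coeffA, neg_mul, Real.cosh_neg, Real.sinh_neg]; ring
  have e6 : partialDeriv (coeffB a b ω) (-ε, t) = -partialDeriv (coeffB a b ω) (ε, t) := by
    simp only [partialDeriv_coeffB, neg_mul, Real.cosh_neg, Real.sinh_neg]; ring
  simp only [deformCurve, deformCurve', e1, e2, e3, e4, e5, e6]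
  rw [h]
  ring

/-! ### Loss of area and the smaller body. -/

namespace IsHexCurve

variable {K : Set Plane} {τ τ₁ τ₂ : ZMod 6 → ℝ → Plane} {w a b : ℝ}

/-- The deformations of small amplitude consist of strictly convex arcs, and for a suitable
frequency some of them sweep a smaller area. -/
theorem exists_deformation (h : IsHexCurve K τ τ₁ τ₂ w a b) {c d : ℝ} (hcd : Icc c d ⊆ Ioo a b)
    (harc : ∀ j, IsArc (τ j) (τ₁ j) (τ₂ j) c d) :
    ∃ ω ε : ℝ, ∃ Φ₂ : ZMod 6 → ℝ → Plane,
      (∀ j, IsArc (deformCurve τ c d ω ε j) (deformCurve' τ τ₁ c d ω ε j) (Φ₂ j) c d) ∧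
      ∑ j, ∫ t in c..d, wedge (deformCurve τ c d ω ε j t) (deformCurve' τ τ₁ c d ω ε j t) <
        ∑ j, ∫ t in c..d, wedge (τ j t) (τ₁ j t) := by
  have hlt := (harc 0).lt
  have hE : ContinuousOn (fun t => ∑ j, wedge (τ j t) (τ₁ j t)) (Icc c d) :=
    continuousOn_finsetSum _ fun j _ => (harc j).continuousOn.wedge (harc j).continuousOn'
  obtain ⟨M, hM⟩ := isCompact_Icc.bddAbove_image hE
  have hM' : ∀ t ∈ Icc c d, ∑ j, wedge (τ j t) (τ₁ j t) ≤ M := fun t ht => hM ⟨t, ht, rfl⟩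
  -- This frequency makes the bracket in `sum_wedge_deformCurve_add` at most `M - (M + 1) = -1`. It
  -- is fixed before `ε`, so that stability of arcs applies to a single family.
  set ω : ℝ := -(√3 * (M + 1) / (6 * w)) with hω
  have hωw : 6 * ω / √3 * w = -(M + 1) := by
    have h3 : √3 ≠ 0 := by positivity
    have := h.pos.ne'
    rw [hω]
    field_simp
  choose Φ₂ hΦ using fun j => exists_isC2Family c d ω j h.hasDerivAt h.hasDerivAt' h.continuousOn
  have h0 : ∀ j, IsArc (deformCurve τ c d ω 0 j) (deformCurve' τ τ₁ c d ω 0 j) (Φ₂ j 0) c d := by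
    intro j
    have e0 : deformCurve τ c d ω 0 j = τ j := funext (deformCurve_zero τ c d ω j)
    have e1 : deformCurve' τ τ₁ c d ω 0 j = τ₁ j := funext (deformCurve'_zero τ τ₁ c d ω j)
    rw [e0, e1]
    have e2 : ∀ t ∈ Icc c d, Φ₂ j 0 t = τ₂ j t := by
      intro t ht
      have := (hΦ j).hasDerivAt' 0 t (hcd ht)
      rw [e1] at this
      exact this.unique (h.hasDerivAt' j t (hcd ht))
    refine ⟨hlt, (harc j).hasDerivAt, fun t ht => ?_, (harc j).pos, fun s hs t ht => ?_⟩
    · rw [e2 t ht]; exact (harc j).hasDerivAt' t ht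
    · rw [e2 t ht]; exact (harc j).curved s hs t ht
  have hev : ∀ᶠ ε in nhds (0 : ℝ), ∀ j,
      IsArc (deformCurve τ c d ω ε j) (deformCurve' τ τ₁ c d ω ε j) (Φ₂ j ε) c d :=
    Filter.eventually_all.2 fun j => (hΦ j).eventually_isArc isOpen_Ioo hcd (h0 j)
  have hev' : ∀ᶠ ε in nhds (0 : ℝ), ∀ j,
      IsArc (deformCurve τ c d ω (-ε) j) (deformCurve' τ τ₁ c d ω (-ε) j) (Φ₂ j (-ε)) c d := by
    have : Filter.Tendsto (fun ε : ℝ => -ε) (nhds 0) (nhds 0) := by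
      simpa using (continuous_neg (G := ℝ)).tendsto 0
    exact this.eventually hev
  obtain ⟨ε, ⟨hε1, hε2⟩, hε0⟩ := (((hev.and hev').filter_mono nhdsWithin_le_nhds).and
    (self_mem_nhdsWithin : ∀ᶠ ε : ℝ in nhdsWithin 0 (Ioi 0), ε ∈ Ioi 0)).exists
  have hε0 : 0 < ε := hε0
  let D : ℝ → ℝ := fun ε =>
    ∑ j, ∫ t in c..d, wedge (deformCurve τ c d ω ε j t) (deformCurve' τ τ₁ c d ω ε j t)
  have hDint (ε : ℝ) (hε : ∀ j, IsArc (deformCurve τ c d ω ε j) (deformCurve' τ τ₁ c d ω ε j)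
      (Φ₂ j ε) c d) :
      IntervalIntegrable (fun t => ∑ j, wedge (deformCurve τ c d ω ε j t)
        (deformCurve' τ τ₁ c d ω ε j t)) volume c d ∧
      D ε = ∫ t in c..d, ∑ j, wedge (deformCurve τ c d ω ε j t) (deformCurve' τ τ₁ c d ω ε j t) := by
    refine ⟨?_, (intervalIntegral.integral_finsetSum fun j _ => (hε j).intervalIntegrable).symm⟩
    exact (continuousOn_finsetSum _ fun j _ =>
      (hε j).continuousOn.wedge (hε j).continuousOn').intervalIntegrable_of_Icc hlt.le
  have hEint := hE.intervalIntegrable_of_Icc (μ := volume) hlt.le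
  have hE0 : ∑ j, ∫ t in c..d, wedge (τ j t) (τ₁ j t) =
      ∫ t in c..d, ∑ j, wedge (τ j t) (τ₁ j t) :=
    (intervalIntegral.integral_finsetSum fun j _ => (harc j).intervalIntegrable).symm
  obtain ⟨i1, d1⟩ := hDint ε hε1
  obtain ⟨i2, d2⟩ := hDint (-ε) hε2
  -- The two areas together are less than twice the old one, so at least one of them is smaller.
  have hlt2 : D ε + D (-ε) < 2 * ∑ j, ∫ t in c..d, wedge (τ j t) (τ₁ j t) := by
    rw [hE0, d1, d2, ← intervalIntegral.integral_add i1 i2, ← intervalIntegral.integral_const_mul,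
      ← sub_pos, ← intervalIntegral.integral_sub (hEint.const_mul 2) (i1.add i2)]
    refine intervalIntegral.intervalIntegral_pos_of_pos_on ((hEint.const_mul 2).sub (i1.add i2))
      (fun t ht => ?_) hlt
    have ht' := Ioo_subset_Icc_self ht
    have hta := hcd ht'
    rw [sum_wedge_deformCurve_add (h.isHex hta) (h.isHex_deriv hta)]
    have hw : wedge (τ 0 t) (τ 2 t) = w := h.wedge_eq 0 t hta
    rw [hw, hωw]
    have hb : 0 < bump c d t := by
      have h1 := sub_pos.2 ht.1
      have h2 := sub_pos.2 ht.2
      unfold bump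
      positivity
    have hsh : 0 < Real.sinh (ε * bump c d t) := Real.sinh_pos_iff.2 (mul_pos hε0 hb)
    have := hM' t ht'
    have hsq : 0 < Real.sinh (ε * bump c d t) ^ 2 := by positivity
    nlinarith
  rcases lt_or_ge (D ε) (∑ j, ∫ t in c..d, wedge (τ j t) (τ₁ j t)) with h1 | h1
  · exact ⟨ω, ε, fun j => Φ₂ j ε, hε1, h1⟩
  · exact ⟨ω, -ε, fun j => Φ₂ j (-ε), hε2, show D (-ε) < _ by linarith⟩

theorem exists_smaller_body_of_pos (h : IsHexCurve K τ τ₁ τ₂ w a b) (hK : IsBody K)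
    (hs : ∀ x ∈ K, -x ∈ K) {t₀ : ℝ} (ht₀ : t₀ ∈ Ioo a b) (hpos : 0 < wedge (τ 0 t₀) (τ₁ 0 t₀)) :
    ∃ K', IsBody K' ∧ (∀ x ∈ K', -x ∈ K') ∧ volume.real K' < volume.real K ∧
      ∀ u v, IsInscribed K' u v → ∃ u' v', IsInscribed K u' v' ∧ wedge u' v' ≤ wedge u v := by
  obtain ⟨c', c, d, d', hc', hd', hsub, harc, hsepw⟩ :=
    h.exists_arcs hK ht₀ (h.orientation hK ht₀ hpos)
  have hlt := (harc 0).lt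
  have hIcc' : Icc c d ⊆ Ioo c' d' := fun t ht => ⟨hc'.trans_le ht.1, ht.2.trans_lt hd'⟩
  have hIcc := hIcc'.trans hsub
  obtain ⟨ω, ε, Φ₂, hγ, harea⟩ := h.exists_deformation hIcc harc
  set γ := deformCurve τ c d ω ε with hγdef
  have hsep := notMem_cone_of_separated hlt hc' hd' (fun j t ht => h.neg_eq j t (hsub ht)) hsepw
    fun j => (harc j).wedge_ends_pos
  obtain ⟨K', hK', hout, hin, hvol⟩ := exists_replace_arcs hK hc' hd' harc hγ
    (fun j => deformCurve_left τ c d ω j ε) (fun j => deformCurve_right τ c d ω j ε)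
    (fun j => deformCurve'_left τ τ₁ c d ω j ε) (fun j => deformCurve'_right τ τ₁ c d ω j ε)
    (fun j t ht => h.mem_frontier j t (hsub ht)) hsep Finset.univ
  have hhex {t : ℝ} (ht : t ∈ Icc c d) : IsHex fun j => γ j t := (h.isHex (hIcc ht)).deform _ _ _
  have hwγ (j : ZMod 6) {t : ℝ} (ht : t ∈ Icc c d) : wedge (γ j t) (γ (j + 1) t) = w := by
    have h1 := (hhex ht).wedge_add_one j
    have h2 := (h.isHex (hIcc ht)).wedge_deform (coeffC c d (ε, t)) (coeffA c d ω (ε, t))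
      (coeffB c d ω (ε, t))
    rw [coeff_det, one_mul] at h2
    exact h1.trans (h2.trans (h.wedge_eq 0 t (hIcc ht)))
  have hcone (j : ZMod 6) {x : Plane} (hx : x ∈ cone (τ j c) (τ j d)) :
      -x ∈ cone (τ (j + 3) c) (τ (j + 3) d) := by
    rw [h.neg_eq j c (hIcc (left_mem_Icc.2 hlt.le)), h.neg_eq j d (hIcc (right_mem_Icc.2 hlt.le))]
    exact neg_mem_cone hx
  have hs' : ∀ x ∈ K', -x ∈ K' := by
    intro x hx
    by_cases hxc : ∃ j, x ∈ cone (τ j c) (τ j d)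
    · obtain ⟨j, hj⟩ := hxc
      obtain ⟨t, ht, r, hr, rfl⟩ := ((hin j (Finset.mem_univ j) x hj).1).1 hx
      refine ((hin (j + 3) (Finset.mem_univ _) _ (hcone j hj)).1).2 ⟨t, ht, r, hr, ?_⟩
      have : γ (j + 3) t = -γ j t := (hhex ht).neg j
      rw [this, smul_neg]
    · have hnx : ¬ ∃ j, -x ∈ cone (τ j c) (τ j d) := by
        rintro ⟨j, hj⟩
        exact hxc ⟨j + 3, by simpa using hcone j hj⟩
      push Not at hxc hnx
      exact ((hout _ fun j _ => hnx j).1).2 (hs x (((hout x fun j _ => hxc j).1).1 hx))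
  have hfr (j : ZMod 6) {t : ℝ} (ht : t ∈ Icc c d) : γ j t ∈ frontier K' := by
    have hm := (hγ j).mem_cone ht
    rw [show γ j c = τ j c from deformCurve_left τ c d ω j ε,
      show γ j d = τ j d from deformCurve_right τ c d ω j ε] at hm
    exact ((hin j (Finset.mem_univ j) _ hm).2).2 ⟨t, ht, rfl⟩
  -- A boundary point of `K'` in one of the cones is a vertex of a deformed hexagon, and every
  -- hexagon inscribed there has the area of that one.
  have hfrw : ∀ u v, IsInscribed K' u v → (∃ j, u ∈ cone (τ j c) (τ j d)) → wedge u v = w := by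
    rintro u v huv ⟨j, hj⟩
    obtain ⟨t, ht, rfl⟩ := ((hin j (Finset.mem_univ j) u hj).2).1 huv.left
    have hins : IsInscribed K' (γ j t) (γ (j + 1) t) := by
      refine ⟨hfr j ht, hfr (j + 1) ht, ?_, (hwγ j ht).symm ▸ h.pos⟩
      have : γ (j + 1) t = γ j t + γ (j + 2) t := (hhex ht).add j
      rw [this, add_sub_cancel_left]
      exact hfr (j + 2) ht
    rw [huv.wedge_eq hK' hs' hins, hwγ j ht]
  have hcm : c ∈ Ioo a b := hIcc (left_mem_Icc.2 hlt.le)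
  -- The original hexagon at time `c` serves as the comparison hexagon in `K` for every hexagon that
  -- meets a new arc.
  have hτ : IsInscribed K (τ 0 c) (τ 1 c) ∧ wedge (τ 0 c) (τ 1 c) = w := by
    have hw : wedge (τ 0 c) (τ 1 c) = w := h.wedge_add_one 0 hcm
    refine ⟨⟨h.mem_frontier 0 c hcm, h.mem_frontier 1 c hcm, ?_, hw.symm ▸ h.pos⟩, hw⟩
    have : τ 1 c = τ 0 c + τ 2 c := h.add_eq 0 hcm
    rw [this, add_sub_cancel_left]
    exact h.mem_frontier 2 c hcm
  refine ⟨K', hK', hs', ?_, ?_⟩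
  · rw [hvol, ← Finset.mul_sum, Finset.sum_sub_distrib]
    linarith
  · intro u v huv
    have hrot {u v : Plane} : wedge v (v - u) = wedge u v := by
      rw [wedge_sub_right, wedge_self, wedge_swap v u]; ring
    by_cases hu : ∃ j, u ∈ cone (τ j c) (τ j d)
    · exact ⟨_, _, hτ.1, by rw [hτ.2, hfrw u v huv hu]⟩
    have huv1 := huv.rotate hs'
    by_cases hv : ∃ j, v ∈ cone (τ j c) (τ j d)
    · exact ⟨_, _, hτ.1, by rw [hτ.2, ← hrot, hfrw _ _ huv1 hv]⟩
    have huv2 := huv1.rotate hs'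
    by_cases hvu : ∃ j, v - u ∈ cone (τ j c) (τ j d)
    · exact ⟨_, _, hτ.1, by rw [hτ.2, ← hrot, ← hrot, hfrw _ _ huv2 hvu]⟩
    push Not at hu hv hvu
    exact ⟨u, v, ⟨((hout u fun j _ => hu j).2).1 huv.left, ((hout v fun j _ => hv j).2).1 huv.right,
      ((hout _ fun j _ => hvu j).2).1 huv.sub, huv.pos⟩, le_rfl⟩

/-- A body with a curve of inscribed affine-regular hexagons with curved vertices can be replaced
by a body of smaller area that does not have smaller inscribed affine-regular hexagons. -/
theorem exists_smaller_body (h : IsHexCurve K τ τ₁ τ₂ w a b) (hK : IsBody K)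
    (hs : ∀ x ∈ K, -x ∈ K) :
    ∃ K', IsBody K' ∧ (∀ x ∈ K', -x ∈ K') ∧ volume.real K' < volume.real K ∧
      ∀ u v, IsInscribed K' u v → ∃ u' v', IsInscribed K u' v' ∧ wedge u' v' ≤ wedge u v := by
  obtain ⟨t₀, ht₀⟩ := nonempty_Ioo.2 h.lt
  have hne := (hK.tangent (h.hasDerivAt 0 t₀ ht₀) (h.eventually_mem_frontier 0 ht₀)
    (h.deriv_ne_zero 0 ht₀)).1
  rcases hne.lt_or_gt with hlt | hgt
  · refine h.reverse.exists_smaller_body_of_pos hK hs (t₀ := -t₀)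
      ⟨by linarith [ht₀.2], by linarith [ht₀.1]⟩ ?_
    rw [neg_neg, wedge_neg_right]
    linarith
  · exact h.exists_smaller_body_of_pos hK hs ht₀ hgt

end IsHexCurve

/-- The curve of hexagons that belongs to a multi-curve of rank three. -/
theorem exists_isHexCurve {σ : ZMod 6 → ℝ → Plane} {t₀ t₁ : ℝ} {K : Set Plane} {c : Plane} {r : ℝ}
    (hσ : IsMultiCurve σ t₀ t₁) (hrank : HasWellDefinedRank σ t₀ t₁) (h3 : rank σ t₀ t₁ = 3)
    (hr : 0 < r) (hfr : ∀ j, ∀ t ∈ Icc t₀ t₁, c + r • σ j t ∈ frontier K) :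
    ∃ τ τ₁ τ₂ w, IsHexCurve (-c +ᵥ K) τ τ₁ τ₂ w t₀ t₁ := by
  have hseg : ∀ j, Even j → ¬ IsLineSegment (σ j) t₀ t₁ := by
    -- Only three indices are even, so rank three leaves no even curve that is a segment.
    have hsub : {j : ZMod 6 | Even j ∧ ¬ IsLineSegment (σ j) t₀ t₁} ⊆ ({0, 2, 4} : Set (ZMod 6)) := by
      rintro j ⟨hj, -⟩
      have : ∀ j : ZMod 6, Even j → j = 0 ∨ j = 2 ∨ j = 4 := by
        unfold Even; decide
      exact this j hj
    have hcard : ({0, 2, 4} : Set (ZMod 6)).ncard = 3 := by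
      rw [Set.ncard_eq_toFinset_card']; decide
    have heq := Set.eq_of_subset_of_ncard_le hsub (by rw [hcard]; exact h3.ge)
    intro j hj
    have hmem : j ∈ ({0, 2, 4} : Set (ZMod 6)) := by
      have : ∀ j : ZMod 6, Even j → j = 0 ∨ j = 2 ∨ j = 4 := by
        unfold Even; decide
      exact this j hj
    rw [← heq] at hmem
    exact hmem.2
  -- On the open interval `deriv` is the true derivative, while at the end points the one-sided
  -- regularity does not control it.
  have hC (j : ZMod 6) : ContDiffOn ℝ 2 (σ j) (Ioo t₀ t₁) :=
    (hrank.contDiffOn j).mono Ioo_subset_Icc_self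
  have hC1 (j : ZMod 6) : ContDiffOn ℝ 1 (deriv (σ j)) (Ioo t₀ t₁) :=
    (contDiffOn_succ_iff_deriv_of_isOpen isOpen_Ioo (n := 1)).1 (by rw [one_add_one_eq_two]; exact hC j) |>.2.2
  have hC0 (j : ZMod 6) : ContinuousOn (deriv (deriv (σ j))) (Ioo t₀ t₁) :=
    ((contDiffOn_succ_iff_deriv_of_isOpen isOpen_Ioo (n := 0)).1 (by simpa using hC1 j)).2.2.continuousOn
  have hd (j : ZMod 6) {t : ℝ} (ht : t ∈ Ioo t₀ t₁) : HasDerivAt (σ j) (deriv (σ j) t) t :=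
    (((hC j).differentiableOn (by norm_num)).differentiableAt (isOpen_Ioo.mem_nhds ht)).hasDerivAt
  have hd' (j : ZMod 6) {t : ℝ} (ht : t ∈ Ioo t₀ t₁) :
      HasDerivAt (deriv (σ j)) (deriv (deriv (σ j)) t) t :=
    (((hC1 j).differentiableOn (by norm_num)).differentiableAt (isOpen_Ioo.mem_nhds ht)).hasDerivAt
  have hcurv : ∀ j, Even j → ∀ t ∈ Ioo t₀ t₁, wedge (deriv (σ j) t) (deriv (deriv (σ j)) t) ≠ 0 := by
    intro j hj t ht h0
    rcases hrank.segment_or_curved j with h | h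
    · exact hseg j hj h
    · exact h t ht (by rw [curvature, h0, zero_div])
  have hcurv' : ∀ j, ∀ t ∈ Ioo t₀ t₁, wedge (deriv (σ j) t) (deriv (deriv (σ j)) t) ≠ 0 := by
    intro j t ht
    -- The rank concerns even indices only; a curve of odd index is the negative of one of even
    -- index and has the same wedge product of derivatives.
    have hpar : ∀ j : ZMod 6, Even j ∨ ∃ i, Even i ∧ j = i + 3 := by
      unfold Even; decide
    rcases hpar j with hj | ⟨i, hi, rfl⟩
    · exact hcurv j hj t ht
    · have e0 : ∀ s ∈ Ioo t₀ t₁, σ (i + 3) s = -σ i s := fun s hs =>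
        (hσ.isMultiPoint s (Ioo_subset_Icc_self hs)).neg i
      have e1 : ∀ s ∈ Ioo t₀ t₁, deriv (σ (i + 3)) s = -deriv (σ i) s := fun s hs =>
        ((hd i hs).neg.congr_of_eventuallyEq
          (Filter.eventually_of_mem (isOpen_Ioo.mem_nhds hs) e0)).deriv
      have e2 : deriv (deriv (σ (i + 3))) t = -deriv (deriv (σ i)) t :=
        ((hd' i ht).neg.congr_of_eventuallyEq
          (Filter.eventually_of_mem (isOpen_Ioo.mem_nhds ht) e1)).deriv
      rw [e1 t ht, e2, wedge_neg_left, wedge_neg_right, neg_neg]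
      exact hcurv i hi t ht
  have hmp {t : ℝ} (ht : t ∈ Ioo t₀ t₁) := hσ.isMultiPoint t (Ioo_subset_Icc_self ht)
  refine ⟨fun j t => r • σ j t, fun j t => r • deriv (σ j) t, fun j t => r • deriv (deriv (σ j)) t,
    r ^ 2 * (√3 / 2), hσ.lt, fun j t ht => (hd j ht).const_smul r,
    fun j t ht => (hd' j ht).const_smul r, fun j => (hC0 j).const_smul r, fun j t ht => ?_,
    fun j t ht => ?_, fun j t ht => ?_, by positivity, fun j t ht => ?_, fun j t ht => ?_⟩
  · rw [← smul_add, ← smul_add, (hmp ht).sum_eq_zero j, smul_zero]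
  · rw [(hmp ht).neg j, smul_neg]
  · rw [wedge_smul_left, wedge_smul_right, (hmp ht).wedge_eq j]; ring
  · have h1 : frontier (-c +ᵥ K) = -c +ᵥ frontier K := by
      simp only [frontier, closure_vadd, interior_vadd, Set.vadd_set_sdiff]
    rw [h1]
    exact ⟨_, hfr j t (Ioo_subset_Icc_self ht), by simp⟩
  · rw [wedge_smul_left, wedge_smul_right]
    exact mul_ne_zero hr.ne' (mul_ne_zero hr.ne' (hcurv' j t ht))

end Reinhardt

theorem mainTheorem2 (K : Set Reinhardt.Plane) (hK : Reinhardt.IsMiserly K) :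
    ¬ ∃ (σ : ZMod 6 → ℝ → Reinhardt.Plane) (t₀ t₁ : ℝ),
      Reinhardt.IsMultiCurve σ t₀ t₁ ∧
      Reinhardt.ParametrizesBoundary σ t₀ t₁ K ∧
      Reinhardt.HasWellDefinedRank σ t₀ t₁ ∧
      Reinhardt.rank σ t₀ t₁ = 3 := by
  rintro ⟨σ, t₀, t₁, hσ, ⟨c, r, hc, hr, hfr⟩, hrank, h3⟩
  obtain ⟨hB, hs⟩ := Reinhardt.isBody_neg_vadd hK.domain hc
  obtain ⟨τ, τ₁, τ₂, w, hτ⟩ := Reinhardt.exists_isHexCurve hσ hrank h3 hr hfr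
  obtain ⟨K', hK', hs', hvol, hex⟩ := hτ.exists_smaller_body hB hs
  have h1 := Reinhardt.deltaLat_lt hB hs hK' hs' hvol hex
  rw [Reinhardt.deltaLat_vadd, hK.minimal] at h1
  exact absurd (Reinhardt.deltaMin_le (hK'.isDomain hs')) (not_le.2 h1)
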